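/- **Corollary 5.4 (Cowling–Price type).** For $f=f_0+if_1+jf_2+kf_3\in L^1(\mathbb R^2,\mathbb H)$ with real-valued $f_m$, let $$\mathcal F\{f\}(\xi)=\int_{\mathbb R^2}e^{-i2\pi\xi_1x_1}f(x)\,e^{-j2\pi\xi_2x_2}\,dx,\qquad \|\mathcal F\{f\}(\xi)\|_Q=\Big(\sum_{m=0}^{3}|\mathcal F\{f_m\}(\xi)|_Q^2\Big)^{1/2},$$ where $|\cdot|_Q$ is the modulus of a quaternion. Let $1<p,q<\infty$ with $1/p+1/q=1$, let $\alpha,\beta>0$ and $d_1,d_2\ge 0$ be real, and let $f\in L^2(\mathbb R^2,\mathbb H)$ satisfy $$\int_{\mathbb R^2}\Big(\frac{|f(x)|_Q}{(1+|x|)^{d_1}}\,e^{2\pi\alpha|x|^2}\Big)^p dx<\infty,\qquad \int_{\mathbb R^2}\Big(\frac{\|\mathcal F\{f\}(y)\|_Q}{(1+|y|)^{d_2}}\,e^{2\pi\beta|y|^2}\Big)^q dy<\infty .$$ (The first condition implies $f\in L^1(\mathbb R^2,\mathbb H)$, so that $\mathcal F\{f\}$ is defined.) Then, almost everywhere: (i)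 $f=0$ if $\alpha\beta>\tfrac14$; (ii) if $\alpha\beta=\tfrac14$, then $f(x)=P(x)e^{-2\pi\alpha|x|^2}$, where $P$ is a polynomial in $x_1,x_2$ with quaternion coefficients of degree $<\min\{d_1-2/p,\ d_2-2/q\}$ (the zero polynomial has degree $-\infty$, so $f=0$ if this minimum is $\le 0$). In particular, the degree is $<\min\{d-2/p,\,d-2/q\}$ when $d_1=d_2=d$, and it is $<\min\{(d-2)/p,\,(d-2)/q\}$ when $d_1=d/p$ and $d_2=d/q$, that is, when the weights $(1+|x|)^{-d}$ and $(1+|y|)^{-d}$ stand outside the powers $p$ and $q$. -/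

import Mathlib

open MeasureTheory
open scoped Quaternion

namespace QFT

/-- The plane with its Euclidean norm and Lebesgue measure. -/
abbrev Plane : Type := EuclideanSpace ℝ (Fin 2)

/-- The quaternion unit `i`. -/
def qi : ℍ[ℝ] := ⟨0, 1, 0, 0⟩

/-- The quaternion unit `j`. -/
def qj : ℍ[ℝ] := ⟨0, 0, 1, 0⟩

@[simp] theorem qi_re : qi.re = 0 := rfl
@[simp] theorem qi_imI : qi.imI = 1 := rfl
@[simp] theorem qi_imJ : qi.imJ = 0 := rfl
@[simp] theorem qi_imK : qi.imK = 0 := rfl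
@[simp] theorem qj_re : qj.re = 0 := rfl
@[simp] theorem qj_imI : qj.imI = 0 := rfl
@[simp] theorem qj_imJ : qj.imJ = 1 := rfl
@[simp] theorem qj_imK : qj.imK = 0 := rfl

/-- `e^{μθ}` for a pure unit quaternion `μ`, by Euler's formula `cos θ + μ sin θ`. -/
noncomputable def cis (μ : ℍ[ℝ]) (θ : ℝ) : ℍ[ℝ] :=
  (Real.cos θ : ℍ[ℝ]) + μ * (Real.sin θ : ℍ[ℝ])

/-- The two-sided quaternion Fourier transform
`∫ e^{-i 2π ξ₁ x₁} f(x) e^{-j 2π ξ₂ x₂} dx` of an integrable function.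
The integrand has the same modulus as `f`, so the integral converges iff `f` is integrable. -/
noncomputable def fourier (f : Plane → ℍ[ℝ]) (ξ : Plane) : ℍ[ℝ] :=
  ∫ x : Plane, cis qi (-(2 * Real.pi * ξ 0 * x 0)) * f x * cis qj (-(2 * Real.pi * ξ 1 * x 1))

/-- The four real components of a quaternion `q = q₀ + i q₁ + j q₂ + k q₃`. -/
def component (m : Fin 4) (q : ℍ[ℝ]) : ℝ :=
  ![q.re, q.imI, q.imJ, q.imK] m

/-- The modulus `‖𝓕{f}(ξ)‖_Q = (∑ₘ |𝓕{fₘ}(ξ)|²)^{1/2}`, where `f = f₀ + i f₁ + j f₂ + k f₃` with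
real-valued `fₘ`. -/
noncomputable def fourierModulus (f : Plane → ℍ[ℝ]) (ξ : Plane) : ℝ :=
  Real.sqrt (∑ m : Fin 4, ‖fourier (fun x => ((component m (f x) : ℝ) : ℍ[ℝ])) ξ‖ ^ 2)

/-- The quaternion-valued polynomial functions of two real variables, given by their four real
components, `P = P₀ + i P₁ + j P₂ + k P₃`. -/
noncomputable def polyEval (P : Fin 4 → MvPolynomial (Fin 2) ℝ) (x : Plane) : ℍ[ℝ] :=
  ⟨MvPolynomial.eval (fun i => x i) (P 0), MvPolynomial.eval (fun i => x i) (P 1),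
    MvPolynomial.eval (fun i => x i) (P 2), MvPolynomial.eval (fun i => x i) (P 3)⟩

/-- The degree of `P` is `< r`, the zero polynomial having degree `-∞`
(so that `P = 0` when `r ≤ 0`). -/
def DegreeLT (P : Fin 4 → MvPolynomial (Fin 2) ℝ) (r : ℝ) : Prop :=
  ∀ m, P m ≠ 0 → ((P m).totalDegree : ℝ) < r

end QFT

/-! The modulus `fourierModulus` dominates the transform of each real component of `f`, and the
real-linear map `toComplexL` reads the complex Fourier transform of a real function off the
quaternionic one. So it is enough to treat one real function g with complex transform ĝ, both
controlled by the given weights.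

Let αβ = 1/4, b = 2πα and c = 2πβ. Then c = π²/b, that is, the two Gaussians are dual. The decay of
g extends ĝ from a line y + te to an entire function of z bounded by a polynomial times exp(c (Im
z)²) (`exists_norm_slice_le`). If y is orthogonal to e, multiplying by exp(c(‖y‖² + z²)) leaves
growth at most exp(c (Re z)²), up to a polynomial. On almost every coordinate line Fubini also gives
polynomial growth in the mean for real z. Phragmén–Lindelöf in the four quadrants and Liouville then
make the product a polynomial (`exists_polynomial_of_growth`). A continuous function that is a
polynomial of bounded degree on almost every horizontal and vertical line is a polynomial
(`exists_mvPolynomial_of_ae`), so ĝ = Q exp(-c|ξ|²), and Fourier inversion gives g = P exp(-b|x|²)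
with deg P ≤ deg Q.

In the two hypotheses the Gaussians now cancel, and what remains is the integrability of
(|P|/(1+|x|)^d₁)^p and (|Q|/(1+|y|)^d₂)^q. A polynomial of degree n has size r^n on a ball of radius
comparable to r at distance comparable to r, whose area is of order r². This gives both degree
bounds (`totalDegree_lt_of_integrable`).

If αβ > 1/4, lowering α to 1/(4β) gains a Gaussian factor that absorbs (1+|x|)^d₁. The critical case
with d₁ = 0 then asks for a negative degree, so f = 0. -/

namespace CowlingPrice

/-! ### Phragmén–Lindelöf and Liouville for entire functions -/

open Complex Set Filter Topology

theorem one_add_norm_le_two_mul_norm_add_I {z : ℂ} (hz : 0 ≤ z.im) :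
    1 + ‖z‖ ≤ 2 * ‖z + I‖ := by
  have h1 : ‖z‖ ^ 2 = z.re ^ 2 + z.im ^ 2 := by
    rw [Complex.sq_norm, Complex.normSq_apply]; ring
  have h2 : ‖z + I‖ ^ 2 = z.re ^ 2 + (z.im + 1) ^ 2 := by
    rw [Complex.sq_norm, Complex.normSq_apply]; simp; ring
  refine abs_le_of_sq_le_sq' ?_ (by positivity) |>.2
  nlinarith [sq_nonneg (1 - ‖z‖), norm_nonneg z]

theorem norm_exp_I_mul_sq (s : ℝ) (z : ℂ) :
    ‖cexp (I * s * z ^ 2)‖ = Real.exp (-(2 * s * z.re * z.im)) := by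
  rw [Complex.norm_exp]
  congr 1
  simp [pow_two]
  ring

section Sector

variable {H : ℂ → ℂ} {C a : ℝ} {M : ℕ}

/-- Division by (z + i)^M removes the polynomial factor, with no pole in the closed upper half
plane. The factor exp(isz²) has modulus 1 on the real axis and exp(-2s Re z Im z) in general. -/
theorem norm_div_pow_mul_exp_le (hC : 0 ≤ C) {z : ℂ} (hz : 0 ≤ z.im) {b s : ℝ}
    (hb : ‖H z‖ ≤ C * (1 + ‖z‖) ^ M * Real.exp b) :
    ‖H z / (z + I) ^ M * cexp (I * s * z ^ 2)‖ ≤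
      2 ^ M * C * Real.exp (b - 2 * s * z.re * z.im) := by
  have h1 := one_add_norm_le_two_mul_norm_add_I hz
  have h0 : 0 < ‖z + I‖ := by linarith [norm_nonneg z]
  rw [norm_mul, norm_div, norm_pow, norm_exp_I_mul_sq, sub_eq_add_neg, Real.exp_add, ← mul_assoc]
  gcongr
  rw [div_le_iff₀ (by positivity)]
  calc ‖H z‖ ≤ C * (1 + ‖z‖) ^ M * Real.exp b := hb
    _ ≤ C * (2 * ‖z + I‖) ^ M * Real.exp b := by gcongr
    _ = _ := by rw [mul_pow]; ring

theorem norm_le_of_sector (hd : Differentiable ℂ H) (hC : 0 ≤ C) (ha : 0 ≤ a)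
    (hg : ∀ z, ‖H z‖ ≤ C * (1 + ‖z‖) ^ M * Real.exp (a * z.re ^ 2))
    (hr : ∀ x : ℝ, ‖H x‖ ≤ C * (1 + |x|) ^ M)
    {θ : ℝ} (hθ0 : 0 < θ) (hθ : θ < Real.pi / 2) {z : ℂ} (hz0 : z ≠ 0) (hz1 : 0 ≤ z.arg)
    (hz2 : z.arg ≤ θ) :
    ‖H z / (z + I) ^ M * cexp (I * (a * Real.cos θ / (2 * Real.sin θ) : ℝ) * z ^ 2)‖ ≤
      2 ^ M * C := by
  -- This value makes a (Re z)² - 2s Re z Im z vanish on the ray arg z = θ, so the product is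
  -- bounded by the same constant on both sides of the sector.
  set s : ℝ := a * Real.cos θ / (2 * Real.sin θ) with hs
  have hsin : 0 < Real.sin θ := Real.sin_pos_of_pos_of_lt_pi hθ0 (by linarith [Real.pi_pos])
  have hcos : 0 < Real.cos θ := Real.cos_pos_of_mem_Ioo ⟨by linarith, hθ⟩
  have hs0 : 0 ≤ s := by positivity
  set K : ℂ → ℂ := fun w => H (cexp w) / (cexp w + I) ^ M * cexp (I * s * (cexp w) ^ 2) with hK
  have him : ∀ w : ℂ, 0 ≤ w.im → w.im ≤ θ → 0 ≤ (cexp w).im := fun w h1 h2 => by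
    rw [Complex.exp_im]
    exact mul_nonneg (Real.exp_pos _).le
      (Real.sin_nonneg_of_nonneg_of_le_pi h1 (by linarith [Real.pi_pos]))
  have hre : ∀ w : ℂ, 0 ≤ w.im → w.im ≤ θ → 0 ≤ (cexp w).re := fun w h1 h2 => by
    rw [Complex.exp_re]
    exact mul_nonneg (Real.exp_pos _).le
      (Real.cos_nonneg_of_mem_Icc ⟨by linarith [Real.pi_pos], by linarith⟩)
  have key : ‖K (Complex.log z)‖ ≤ 2 ^ M * C := by
    refine PhragmenLindelof.horizontal_strip (a := 0) (b := θ) ?_ ?_ ?_ ?_ ?_ ?_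
    · refine DifferentiableOn.diffContOnCl fun w hw => ?_
      have hw' : w ∈ im ⁻¹' Icc 0 θ :=
        closure_minimal (preimage_mono Ioo_subset_Icc_self)
          (isClosed_Icc.preimage continuous_im) hw
      have hne : cexp w + I ≠ 0 := by
        have := one_add_norm_le_two_mul_norm_add_I (him w hw'.1 hw'.2)
        rw [← norm_pos_iff]; linarith [norm_nonneg (cexp w)]
      refine DifferentiableAt.differentiableWithinAt ?_
      have d1 : DifferentiableAt ℂ (fun w => H (cexp w)) w :=
        DifferentiableAt.comp w (hd _) differentiableAt_exp
      have d2 : DifferentiableAt ℂ (fun w => (cexp w + I) ^ M) w := by fun_prop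
      have d3 : DifferentiableAt ℂ (fun w => cexp (I * s * (cexp w) ^ 2)) w := by fun_prop
      exact (d1.fun_div d2 (pow_ne_zero M hne)).fun_mul d3
    -- In the coordinate w = log z the sector is a strip of width θ and the growth is exp(a e^{2|Re
    -- w|}). The exponent 2 is admissible because 2 < π/θ, which is where θ < π/2 is needed.
    · refine ⟨2, ?_, a, ?_⟩
      · rw [sub_zero, lt_div_iff₀ hθ0]; linarith
      · refine Asymptotics.IsBigO.of_bound (2 ^ M * C) ?_
        refine eventually_inf_principal.2 (Eventually.of_forall fun w hw => ?_)
        refine (norm_div_pow_mul_exp_le hC (him w hw.1.le hw.2.le) (hg _)).trans ?_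
        rw [Real.norm_eq_abs, abs_of_pos (Real.exp_pos _)]
        gcongr
        have h3 : 0 ≤ 2 * s * (cexp w).re * (cexp w).im :=
          mul_nonneg (mul_nonneg (by positivity) (hre w hw.1.le hw.2.le))
            (him w hw.1.le hw.2.le)
        have h4 : (cexp w).re ^ 2 ≤ Real.exp (2 * |w.re|) := by
          calc (cexp w).re ^ 2 ≤ ‖cexp w‖ ^ 2 := by
                rw [← sq_abs]; gcongr; exact Complex.abs_re_le_norm _
            _ = Real.exp (2 * w.re) := by
                rw [Complex.norm_exp, ← Real.exp_nat_mul]; norm_num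
            _ ≤ _ := by gcongr; exact le_abs_self _
        nlinarith
    · intro w hw
      have h1 : cexp w = (Real.exp w.re : ℝ) := by
        apply Complex.ext
        · rw [Complex.exp_re, hw, ofReal_re]; simp
        · rw [Complex.exp_im, hw]; simp
      have h2 := norm_div_pow_mul_exp_le (M := M) (s := s) (b := 0) hC
        (him w hw.ge (hw.trans_le hθ0.le)) (H := H)
        (by rw [h1]; simpa using hr (Real.exp w.re))
      refine h2.trans (le_of_eq ?_)
      rw [h1]; simp
    · intro w hw
      refine (norm_div_pow_mul_exp_le hC (him w (hθ0.le.trans hw.ge) hw.le) (hg _)).trans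
        (le_of_eq ?_)
      rw [Complex.exp_re, Complex.exp_im, hw]
      have : a * (Real.exp w.re * Real.cos θ) ^ 2 -
          2 * s * (Real.exp w.re * Real.cos θ) * (Real.exp w.re * Real.sin θ) = 0 := by
        rw [hs]; field_simp; ring
      rw [this]; simp
    · rwa [Complex.log_im]
    · rwa [Complex.log_im]
  simpa [hK, Complex.exp_log hz0] using key

/-- The bound in the sector of angle θ has a constant independent of θ. As θ → π/2 the correcting
coefficient a cos θ/(2 sin θ) tends to 0, and the exponential factor disappears. -/
theorem norm_le_of_re_pos_of_im_nonneg (hd : Differentiable ℂ H) (hC : 0 ≤ C) (ha : 0 ≤ a)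
    (hg : ∀ z, ‖H z‖ ≤ C * (1 + ‖z‖) ^ M * Real.exp (a * z.re ^ 2))
    (hr : ∀ x : ℝ, ‖H x‖ ≤ C * (1 + |x|) ^ M) {z : ℂ} (hre : 0 < z.re) (him : 0 ≤ z.im) :
    ‖H z‖ ≤ 2 ^ M * C * (1 + ‖z‖) ^ M := by
  have hz0 : z ≠ 0 := by rintro rfl; simp at hre
  have harg : z.arg < Real.pi / 2 :=
    (abs_lt.1 (Complex.abs_arg_lt_pi_div_two_iff.2 (Or.inl hre))).2
  have harg0 : 0 ≤ z.arg := Complex.arg_nonneg_iff.2 him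
  have hne : 0 < ‖z + I‖ := by
    linarith [one_add_norm_le_two_mul_norm_add_I him, norm_nonneg z]
  have ht : Tendsto (fun θ : ℝ => ‖H z‖ / ‖z + I‖ ^ M *
      Real.exp (-(2 * (a * Real.cos θ / (2 * Real.sin θ)) * z.re * z.im)))
      (𝓝[<] (Real.pi / 2)) (𝓝 (‖H z‖ / ‖z + I‖ ^ M * 1)) := by
    refine tendsto_nhdsWithin_of_tendsto_nhds ?_
    have hc : ContinuousAt (fun θ : ℝ => ‖H z‖ / ‖z + I‖ ^ M *
      Real.exp (-(2 * (a * Real.cos θ / (2 * Real.sin θ)) * z.re * z.im))) (Real.pi / 2) := by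
      have : 2 * Real.sin (Real.pi / 2) ≠ 0 := by simp
      fun_prop (disch := assumption)
    simpa [ContinuousAt] using hc
  have hle := le_of_tendsto ht (b := 2 ^ M * C) (by
    filter_upwards [Ioo_mem_nhdsLT harg] with θ hθ
    have := norm_le_of_sector hd hC ha hg hr (harg0.trans_lt hθ.1) hθ.2 hz0 harg0 hθ.1.le
    rwa [norm_mul, norm_div, norm_pow, norm_exp_I_mul_sq] at this)
  rw [mul_one, div_le_iff₀ (by positivity)] at hle
  refine hle.trans ?_
  gcongr
  refine (norm_add_le _ _).trans ?_
  simp [add_comm]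

/-- The other quadrants follow by conjugation and z ↦ -z. On the imaginary axis the Gaussian factor
is already 1. -/
theorem norm_le_of_growth (hd : Differentiable ℂ H) (hC : 0 ≤ C) (ha : 0 ≤ a)
    (hg : ∀ z, ‖H z‖ ≤ C * (1 + ‖z‖) ^ M * Real.exp (a * z.re ^ 2))
    (hr : ∀ x : ℝ, ‖H x‖ ≤ C * (1 + |x|) ^ M) (z : ℂ) :
    ‖H z‖ ≤ 2 ^ M * C * (1 + ‖z‖) ^ M := by
  have half : ∀ {F : ℂ → ℂ}, Differentiable ℂ F →
      (∀ z, ‖F z‖ ≤ C * (1 + ‖z‖) ^ M * Real.exp (a * z.re ^ 2)) →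
      (∀ x : ℝ, ‖F x‖ ≤ C * (1 + |x|) ^ M) → ∀ z : ℂ, 0 < z.re →
      ‖F z‖ ≤ 2 ^ M * C * (1 + ‖z‖) ^ M := by
    intro F hd hg hr z hz
    rcases le_total 0 z.im with h | h
    · exact norm_le_of_re_pos_of_im_nonneg hd hC ha hg hr hz h
    · have := norm_le_of_re_pos_of_im_nonneg (H := starRingEnd ℂ ∘ F ∘ starRingEnd ℂ)
        (z := starRingEnd ℂ z) (fun w => differentiableAt_conj_conj_iff.2 (hd _)) hC ha
        (fun w => by simpa using hg (starRingEnd ℂ w)) (fun x => by simpa using hr x)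
        (by simpa using hz) (by simpa using h)
      simpa using this
  rcases lt_trichotomy z.re 0 with h | h | h
  · have := half (F := fun w => H (-w)) (hd.comp differentiable_neg)
      (fun w => by simpa using hg (-w)) (fun x => by simpa using hr (-x)) (-z) (by simpa using h)
    simpa using this
  · refine (hg z).trans ?_
    rw [h]
    have : (1 : ℝ) ≤ 2 ^ M := one_le_pow₀ (by norm_num)
    have h2 : 0 ≤ C * (1 + ‖z‖) ^ M := by positivity
    simp only [ne_eq, OfNat.ofNat_ne_zero, not_false_eq_true, zero_pow, mul_zero, Real.exp_zero,
      mul_one]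
    nlinarith
  · exact half hd hg hr z h

end Sector

/-- Liouville's theorem for entire functions of polynomial growth. -/
theorem exists_polynomial_of_norm_le {H : ℂ → ℂ} (hd : Differentiable ℂ H) {C : ℝ} {M : ℕ}
    (hb : ∀ z, ‖H z‖ ≤ C * (1 + ‖z‖) ^ M) :
    ∃ P : Polynomial ℂ, P.natDegree ≤ M ∧ ∀ z, H z = P.eval z := by
  have hzero : ∀ n, M < n → iteratedDeriv n H 0 = 0 := by
    intro n hn
    have hle : ∀ R : ℝ, 1 ≤ R → ‖iteratedDeriv n H 0‖ ≤ n.factorial * (C * 2 ^ M) * R⁻¹ := by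
      intro R hR
      have hR0 : 0 < R := by linarith
      have hC : 0 ≤ C := by simpa using (norm_nonneg _).trans (hb 0)
      refine (norm_iteratedDeriv_le_of_forall_mem_sphere_norm_le (C := C * (2 * R) ^ M) n hR0
        hd.diffContOnCl fun z hz => (hb z).trans ?_).trans ?_
      · have : ‖z‖ = R := by simpa using hz
        rw [this]; gcongr; linarith
      · rw [div_le_iff₀ (by positivity)]
        have h1 : R ^ (M + 1) ≤ R ^ n := pow_le_pow_right₀ hR hn
        have h2 : R ^ M ≤ R⁻¹ * R ^ n := by
          rw [← div_eq_inv_mul, le_div_iff₀ hR0, ← pow_succ]; exact h1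
        calc (n.factorial : ℝ) * (C * (2 * R) ^ M) = n.factorial * (C * 2 ^ M) * R ^ M := by
              rw [mul_pow]; ring
          _ ≤ n.factorial * (C * 2 ^ M) * (R⁻¹ * R ^ n) := by gcongr
          _ = _ := by ring
    have ht : Tendsto (fun R : ℝ => n.factorial * (C * 2 ^ M) * R⁻¹) atTop (𝓝 0) := by
      simpa using tendsto_inv_atTop_zero.const_mul ((n.factorial : ℝ) * (C * 2 ^ M))
    exact norm_le_zero_iff.1 (ge_of_tendsto ht
      (by filter_upwards [eventually_ge_atTop 1] with R hR using hle R hR))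
  refine ⟨∑ n ∈ Finset.range (M + 1),
    Polynomial.C ((n.factorial : ℂ)⁻¹ * iteratedDeriv n H 0) * Polynomial.X ^ n, ?_, fun z => ?_⟩
  · refine Polynomial.natDegree_sum_le_of_forall_le _ _ fun n hn => ?_
    exact (Polynomial.natDegree_C_mul_X_pow_le _ _).trans
      (Nat.lt_succ_iff.1 (Finset.mem_range.1 hn))
  · rw [Polynomial.eval_finsetSum, ← Complex.taylorSeries_eq_of_entire' 0 z hd,
      tsum_eq_sum (s := Finset.range (M + 1))]
    · simp
    · intro n hn
      rw [hzero n (by simpa using hn)]; simp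

/-- An entire function of Gaussian growth along the real direction, and of polynomial growth in
the mean on the real line, is a polynomial. -/
theorem exists_polynomial_of_growth {h : ℂ → ℂ} (hd : Differentiable ℂ h) {C a A : ℝ} {N n : ℕ}
    (ha : 0 ≤ a) (hg : ∀ z, ‖h z‖ ≤ C * (1 + ‖z‖) ^ N * Real.exp (a * z.re ^ 2))
    {w : ℝ → ℝ} (hw : Integrable w) (hw0 : ∀ t, 0 ≤ w t) (hA : 0 ≤ A)
    (hr : ∀ t : ℝ, ‖h t‖ ≤ (1 + w t) * (A * (1 + |t|) ^ n)) :
    ∃ P : Polynomial ℂ, P.natDegree ≤ N + n + 1 ∧ ∀ z, h z = P.eval z := by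
  -- Phragmén–Lindelöf needs pointwise bounds on the real line, while `h` has only a bound in the
  -- mean. A primitive `H` turns the integrable `w` into the constant `B`. Once `H` is a polynomial,
  -- so is its derivative `h`.
  obtain ⟨H, hH0, hH⟩ := hd.isExactOn_univ.with_val_at 0 0
  replace hH : ∀ z, HasDerivAt H (h z) z := fun z => hH z (mem_univ z)
  have hC : 0 ≤ C := by
    have := (norm_nonneg _).trans (hg 0)
    simpa using this
  set B : ℝ := ∫ t, w t with hB
  have hB0 : 0 ≤ B := integral_nonneg hw0
  have h1 : ∀ z, ‖H z‖ ≤ C * (1 + ‖z‖) ^ (N + 1) * Real.exp (a * z.re ^ 2) := by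
    intro z
    -- The segment from 0 to z stays in this set, where the bound on `h` is at most its value at z.
    have hs : Convex ℝ (Metric.closedBall (0 : ℂ) ‖z‖ ∩ re ⁻¹' (Icc (-|z.re|) |z.re|)) :=
      (convex_closedBall _ _).inter ((convex_Icc _ _).linear_preimage reLm)
    have := hs.norm_image_sub_le_of_norm_hasDerivWithin_le (𝕜 := ℂ) (f := H) (x := 0) (y := z)
      (C := C * (1 + ‖z‖) ^ N * Real.exp (a * z.re ^ 2))
      (fun w _ => (hH w).hasDerivWithinAt) (fun w hw => (hg w).trans ?_)
      (by simp) ⟨by simp, abs_le.1 le_rfl⟩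
    · rw [hH0, sub_zero, sub_zero] at this
      refine this.trans ?_
      have h3 : 0 ≤ C * (1 + ‖z‖) ^ N * Real.exp (a * z.re ^ 2) := by positivity
      rw [pow_succ (1 + ‖z‖)]
      nlinarith
    · have h3 : ‖w‖ ≤ ‖z‖ := by simpa using hw.1
      have h4 : w.re ^ 2 ≤ z.re ^ 2 := sq_le_sq.2 (abs_le.2 hw.2)
      gcongr
  have h2 : ∀ x : ℝ, ‖H x‖ ≤ A * (1 + B) * (1 + |x|) ^ (n + 1) := by
    intro x
    have hcont : Continuous fun t : ℝ => h t := hd.continuous.comp continuous_ofReal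
    have e1 : ∫ t in (0 : ℝ)..x, h t = H x - H (0 : ℝ) :=
      intervalIntegral.integral_eq_sub_of_hasDerivAt (fun t _ => (hH t).comp_ofReal)
        (hcont.intervalIntegrable _ _)
    rw [ofReal_zero, hH0, sub_zero] at e1
    rw [← e1]
    refine (intervalIntegral.norm_integral_le_integral_norm_uIoc).trans ?_
    calc ∫ t in uIoc 0 x, ‖h t‖ ≤ ∫ t in uIoc 0 x, (1 + w t) * (A * (1 + |x|) ^ n) := by
          refine setIntegral_mono_on ?_ ?_ measurableSet_uIoc fun t ht => (hr t).trans ?_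
          · exact (intervalIntegrable_iff.1 (hcont.norm.intervalIntegrable 0 x))
          · refine Integrable.mul_const (Integrable.add ?_ hw.integrableOn) _
            exact integrableOn_const (by simp [Set.uIoc]) 
          · have := hw0 t
            have h3 : |t| ≤ |x| := by
              have := abs_sub_left_of_mem_uIcc (uIoc_subset_uIcc ht)
              simpa using this
            gcongr
      _ = (|x| + ∫ t in uIoc 0 x, w t) * (A * (1 + |x|) ^ n) := by
          rw [integral_mul_const, integral_add _ hw.integrableOn]
          · congr 2
            simp [Set.uIoc, measureReal_def]
            rw [max_sub_min_eq_abs]; simp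
          · exact integrableOn_const (by simp [Set.uIoc])
      _ ≤ (|x| + B) * (A * (1 + |x|) ^ n) := by
          gcongr
          exact setIntegral_le_integral hw (Eventually.of_forall hw0)
      _ ≤ _ := by
          rw [pow_succ]
          have h3 : 0 ≤ A * (1 + |x|) ^ n := by positivity
          have h4 : |x| + B ≤ (1 + B) * (1 + |x|) := by nlinarith [abs_nonneg x]
          nlinarith
  set M := N + n + 1
  set C' := C + A * (1 + B)
  have h3 := norm_le_of_growth (C := C') (M := M) (H := H) (fun z => (hH z).differentiableAt)
    (by positivity) ha (fun z => (h1 z).trans ?_) (fun x => (h2 x).trans ?_)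
  · obtain ⟨P, hP, hPe⟩ := exists_polynomial_of_norm_le (fun z => (hH z).differentiableAt) h3
    refine ⟨P.derivative, (P.natDegree_derivative_le.trans (Nat.sub_le _ _)).trans hP,
      fun z => ?_⟩
    have : H = fun z => P.eval z := funext hPe
    exact (hH z).unique (this ▸ P.hasDerivAt z)
  · have : 0 ≤ A * (1 + B) := by positivity
    gcongr
    · exact le_add_of_nonneg_right this
    · linarith [norm_nonneg z]
    · omega
  · gcongr
    · exact le_add_of_nonneg_left hC
    · linarith [abs_nonneg x]
    · omega

end CowlingPrice

/-! ### The Fourier transform on complexified lines -/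

namespace CowlingPrice

open Complex Set Filter Topology FourierTransform
open scoped RealInnerProductSpace

section Slice

theorem norm_cexp_slice {V : Type*} [NormedAddCommGroup V] [InnerProductSpace ℝ V]
    (x y e : V) (z : ℂ) :
    ‖cexp (-(2 * Real.pi * I * (⟪x, y⟫ + z * ⟪x, e⟫)))‖ =
      Real.exp (2 * Real.pi * z.im * ⟪x, e⟫) := by
  rw [Complex.norm_exp]
  congr 1
  simp
  ring

variable {V : Type*} [NormedAddCommGroup V] [InnerProductSpace ℝ V] [FiniteDimensional ℝ V]
  [MeasurableSpace V] [BorelSpace V]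

/-- Bound (1+r)^n by exp(nr) and complete the square, giving up half of the Gaussian. -/
theorem weight_le {b : ℝ} (hb : 0 < b) (n : ℕ) (σ : ℝ) {r : ℝ} (hr : 0 ≤ r) :
    (1 + r) ^ n * Real.exp (σ * r) * Real.exp (-(b * r ^ 2)) ≤
      Real.exp ((n + σ) ^ 2 / (2 * b)) * Real.exp (-(b / 2 * r ^ 2)) := by
  have h1 : (1 + r) ^ n ≤ Real.exp (n * r) := by
    rw [Real.exp_nat_mul]
    gcongr
    linarith [Real.add_one_le_exp r]
  calc (1 + r) ^ n * Real.exp (σ * r) * Real.exp (-(b * r ^ 2))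
      ≤ Real.exp (n * r) * Real.exp (σ * r) * Real.exp (-(b * r ^ 2)) := by gcongr
    _ = Real.exp ((n + σ) * r - b * r ^ 2) := by
        rw [← Real.exp_add, ← Real.exp_add]; ring_nf
    _ ≤ _ := by
        rw [← Real.exp_add]
        gcongr
        have : (n + σ) ^ 2 / (2 * b) + -(b / 2 * r ^ 2) - ((n + σ) * r - b * r ^ 2) =
            ((n + σ) - b * r) ^ 2 / (2 * b) := by field_simp; ring
        have h2 : 0 ≤ ((n + σ) - b * r) ^ 2 / (2 * b) := by positivity
        linarith

theorem integrable_exp_neg_mul_sq_norm {b : ℝ} (hb : 0 < b) :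
    Integrable fun x : V => Real.exp (-(b * ‖x‖ ^ 2)) := by
  have := (GaussianFourier.integrable_cexp_neg_mul_sq_norm_add (V := V) (b := (b : ℂ))
    (by simpa using hb) 0 0).norm
  refine this.congr (Eventually.of_forall fun x => ?_)
  simp only [Complex.norm_exp]
  congr 1
  simp [← ofReal_pow, ← ofReal_mul]

theorem integrable_weight {b : ℝ} (hb : 0 < b) (n : ℕ) (σ : ℝ) :
    Integrable fun x : V => (1 + ‖x‖) ^ n * Real.exp (σ * ‖x‖) * Real.exp (-(b * ‖x‖ ^ 2)) := by
  refine ((integrable_exp_neg_mul_sq_norm (V := V) (half_pos hb)).const_mul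
    (Real.exp ((n + σ) ^ 2 / (2 * b)))).mono' ?_ (Eventually.of_forall fun x => ?_)
  · exact Continuous.aestronglyMeasurable (by fun_prop)
  · rw [Real.norm_eq_abs, abs_of_nonneg (by positivity)]
    exact weight_le hb n σ (norm_nonneg x)

/-- Bounds of the form (1 + w)k with `w` integrable are what an L^p hypothesis provides, through t ≤
1 + t^p. The term wk needs k bounded, the term k needs it integrable. -/
theorem integrable_one_add_mul {w k : V → ℝ} (hw : Integrable w) {K : ℝ} (hk : Integrable k)
    (hK : ∀ x, |k x| ≤ K) : Integrable fun x => (1 + w x) * k x := by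
  simp_rw [add_mul, one_mul]
  exact hk.add (hw.mul_bdd hk.aestronglyMeasurable (Eventually.of_forall hK))

variable {g : V → ℂ} {w : V → ℝ} {b : ℝ} {n : ℕ}

theorem integrable_norm_mul_exp (hb : 0 < b) (hgm : AEStronglyMeasurable g volume)
    (hw : Integrable w)
    (hg : ∀ x, ‖g x‖ ≤ (1 + w x) * ((1 + ‖x‖) ^ n * Real.exp (-(b * ‖x‖ ^ 2)))) (σ : ℝ) :
    Integrable fun x => ‖g x‖ * Real.exp (σ * ‖x‖) := by
  refine (integrable_one_add_mul hw (integrable_weight hb n σ)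
    (K := Real.exp ((n + σ) ^ 2 / (2 * b))) fun x => ?_).mono' ?_
    (Eventually.of_forall fun x => ?_)
  · rw [abs_of_nonneg (by positivity)]
    refine (weight_le hb n σ (norm_nonneg x)).trans (mul_le_of_le_one_right (by positivity) ?_)
    rw [Real.exp_le_one_iff]
    have : 0 ≤ b / 2 * ‖x‖ ^ 2 := by positivity
    linarith
  · exact hgm.norm.mul (Continuous.aestronglyMeasurable (by fun_prop))
  · rw [Real.norm_eq_abs, abs_of_nonneg (by positivity)]
    refine (mul_le_mul_of_nonneg_right (hg x) (Real.exp_pos _).le).trans (le_of_eq ?_)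
    ring

theorem integrable_of_gaussian_bound (hb : 0 < b) (hgm : AEStronglyMeasurable g volume)
    (hw : Integrable w)
    (hg : ∀ x, ‖g x‖ ≤ (1 + w x) * ((1 + ‖x‖) ^ n * Real.exp (-(b * ‖x‖ ^ 2)))) :
    Integrable g := by
  rw [← integrable_norm_iff hgm]
  simpa using integrable_norm_mul_exp hb hgm hw hg 0

/-- The Fourier transform of `g` along the complexified line `y + z • e`. -/
noncomputable def slice (g : V → ℂ) (y e : V) (z : ℂ) : ℂ :=
  ∫ x, g x * cexp (-(2 * Real.pi * I * (⟪x, y⟫ + z * ⟪x, e⟫)))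

theorem slice_ofReal (g : V → ℂ) (y e : V) (t : ℝ) : slice g y e t = 𝓕 g (y + t • e) := by
  rw [Real.fourier_eq', slice]
  refine integral_congr_ae (Eventually.of_forall fun x => ?_)
  simp only [smul_eq_mul, inner_add_right, inner_smul_right]
  rw [mul_comm]
  congr 2
  push_cast
  ring

theorem differentiable_slice (hb : 0 < b) (hgm : AEStronglyMeasurable g volume)
    (hw : Integrable w)
    (hg : ∀ x, ‖g x‖ ≤ (1 + w x) * ((1 + ‖x‖) ^ n * Real.exp (-(b * ‖x‖ ^ 2)))) (y : V) {e : V}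
    (he : ‖e‖ = 1) : Differentiable ℂ (slice g y e) := by
  intro z₀
  have hin : ∀ x : V, |⟪x, e⟫| ≤ ‖x‖ := fun x => by
    simpa [he] using abs_real_inner_le_norm x e
  have hexp : ∀ (x : V) (z : ℂ), Real.exp (2 * Real.pi * z.im * ⟪x, e⟫) ≤
      Real.exp (2 * Real.pi * |z.im| * ‖x‖) := fun x z => by
    refine Real.exp_le_exp.2 ?_
    calc 2 * Real.pi * z.im * ⟪x, e⟫ ≤ |2 * Real.pi * z.im * ⟪x, e⟫| := le_abs_self _
      _ = 2 * Real.pi * |z.im| * |⟪x, e⟫| := by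
          rw [abs_mul, abs_mul, abs_of_pos Real.two_pi_pos]
      _ ≤ _ := by gcongr; exact hin x
  have hmeas : ∀ z : ℂ, AEStronglyMeasurable
      (fun x => g x * cexp (-(2 * Real.pi * I * (⟪x, y⟫ + z * ⟪x, e⟫)))) volume := fun z =>
    hgm.mul (Continuous.aestronglyMeasurable (by fun_prop))
  refine (hasDerivAt_integral_of_dominated_loc_of_deriv_le (Metric.ball_mem_nhds z₀ one_pos)
    (F := fun z x => g x * cexp (-(2 * Real.pi * I * (⟪x, y⟫ + z * ⟪x, e⟫))))
    (F' := fun z x => g x * (cexp (-(2 * Real.pi * I * (⟪x, y⟫ + z * ⟪x, e⟫))) *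
      (-(2 * Real.pi * I * ⟪x, e⟫))))
    -- On the unit ball around z₀ one has |Im z| ≤ |Im z₀| + 1. The additional 2π in the exponent
    -- absorbs the factor 2π|⟪x, e⟫| produced by differentiation.
    (bound := fun x => ‖g x‖ * Real.exp ((2 * Real.pi * (|z₀.im| + 1) + 2 * Real.pi) * ‖x‖))
    (Eventually.of_forall hmeas) ?_ ?_ ?_ ?_ ?_).2.differentiableAt
  · refine (integrable_norm_mul_exp hb hgm hw hg (2 * Real.pi * |z₀.im|)).mono' (hmeas z₀)
      (Eventually.of_forall fun x => ?_)
    rw [norm_mul, norm_cexp_slice]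
    exact mul_le_mul_of_nonneg_left (hexp x z₀) (norm_nonneg _)
  · exact hgm.mul (Continuous.aestronglyMeasurable (by fun_prop))
  · refine Eventually.of_forall fun x z hz => ?_
    rw [norm_mul, norm_mul, norm_cexp_slice, add_mul, Real.exp_add]
    have h1 : |z.im| ≤ |z₀.im| + 1 := by
      have h2 : |(z - z₀).im| ≤ 1 :=
        (Complex.abs_im_le_norm _).trans ((mem_ball_iff_norm.1 hz).le)
      have h3 : |z.im| ≤ |z₀.im| + |(z - z₀).im| := by
        have := abs_add_le z₀.im (z - z₀).im
        simpa using this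
      linarith
    have h4 : ‖(-(2 * Real.pi * I * ⟪x, e⟫) : ℂ)‖ ≤ Real.exp (2 * Real.pi * ‖x‖) := by
      have : ‖(-(2 * Real.pi * I * ⟪x, e⟫) : ℂ)‖ = 2 * Real.pi * |⟪x, e⟫| := by
        simp [abs_of_pos Real.pi_pos]
      rw [this]
      have h5 := Real.add_one_le_exp (2 * Real.pi * ‖x‖)
      have h6 : 2 * Real.pi * |⟪x, e⟫| ≤ 2 * Real.pi * ‖x‖ :=
        mul_le_mul_of_nonneg_left (hin x) Real.two_pi_pos.le
      linarith
    have h7 : Real.exp (2 * Real.pi * z.im * ⟪x, e⟫) ≤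
        Real.exp (2 * Real.pi * (|z₀.im| + 1) * ‖x‖) := (hexp x z).trans (by gcongr)
    exact mul_le_mul_of_nonneg_left
      (mul_le_mul h7 h4 (norm_nonneg _) (Real.exp_pos _).le) (norm_nonneg _)
  · exact integrable_norm_mul_exp hb hgm hw hg _
  · refine Eventually.of_forall fun x z _ => ?_
    have h1 : HasDerivAt (fun z : ℂ => -(2 * Real.pi * I * (⟪x, y⟫ + z * ⟪x, e⟫)))
        (-(2 * Real.pi * I * ⟪x, e⟫)) z := by
      have := ((((hasDerivAt_id z).mul_const (⟪x, e⟫ : ℂ)).const_add (⟪x, y⟫ : ℂ)).const_mul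
        (2 * Real.pi * I)).fun_neg
      simpa using this
    exact h1.cexp.const_mul (g x)

/-- With ρ = π Im z / b, completing the square gives exp(-b‖x‖² + 2π Im z ⟪x, e⟫) = exp(bρ²)
exp(-b‖x - ρe‖²), and bρ² = (π²/b)(Im z)². The translation costs only (1 + |ρ|)^n in the polynomial
weight. The constant does not depend on the line. -/
theorem exists_norm_slice_le (hb : 0 < b)
    (hw : Integrable w) (hw0 : ∀ x, 0 ≤ w x)
    (hg : ∀ x, ‖g x‖ ≤ (1 + w x) * ((1 + ‖x‖) ^ n * Real.exp (-(b * ‖x‖ ^ 2)))) :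
    ∃ C, 0 ≤ C ∧ ∀ (y e : V), ‖e‖ = 1 → ∀ z : ℂ,
      ‖slice g y e z‖ ≤ C * (1 + |z.im|) ^ n * Real.exp (Real.pi ^ 2 / b * z.im ^ 2) := by
  set k : V → ℝ := fun x => (1 + ‖x‖) ^ n * Real.exp (-(b * ‖x‖ ^ 2)) with hk
  have hk0 : ∀ x, 0 ≤ k x := fun x => by positivity
  have hki : Integrable k := by simpa using integrable_weight (V := V) hb n 0
  set K : ℝ := Real.exp (n ^ 2 / (2 * b))
  have hkK : ∀ x, k x ≤ K := fun x => by
    have h1 := weight_le hb n 0 (norm_nonneg x)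
    simp only [zero_mul, Real.exp_zero, mul_one, add_zero] at h1
    refine h1.trans (mul_le_of_le_one_right (by positivity) ?_)
    rw [Real.exp_le_one_iff]
    have : 0 ≤ b / 2 * ‖x‖ ^ 2 := by positivity
    linarith
  have hI : 0 ≤ (∫ x, k x) + K * ∫ x, w x :=
    add_nonneg (integral_nonneg hk0) (mul_nonneg (by positivity) (integral_nonneg hw0))
  refine ⟨(1 + Real.pi / b) ^ n * ((∫ x, k x) + K * ∫ x, w x), by positivity, ?_⟩
  intro y e he z
  set ρ : ℝ := Real.pi * z.im / b with hρ
  have hpt : ∀ x, ‖g x * cexp (-(2 * Real.pi * I * (⟪x, y⟫ + z * ⟪x, e⟫)))‖ ≤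
      ((1 + |ρ|) ^ n * Real.exp (b * ρ ^ 2)) * (k (x - ρ • e) + K * w x) := by
    intro x
    rw [norm_mul, norm_cexp_slice]
    have h1 : ‖x - ρ • e‖ ^ 2 = ‖x‖ ^ 2 - 2 * ρ * ⟪x, e⟫ + ρ ^ 2 := by
      rw [norm_sub_sq_real, inner_smul_right, norm_smul, he]
      simp; ring
    have h2 : Real.exp (-(b * ‖x‖ ^ 2)) * Real.exp (2 * Real.pi * z.im * ⟪x, e⟫) =
        Real.exp (b * ρ ^ 2) * Real.exp (-(b * ‖x - ρ • e‖ ^ 2)) := by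
      rw [← Real.exp_add, ← Real.exp_add, h1]
      congr 1
      have : 2 * Real.pi * z.im = 2 * (b * ρ) := by rw [hρ]; field_simp
      rw [this]; ring
    have h3 : 1 + ‖x‖ ≤ (1 + |ρ|) * (1 + ‖x - ρ • e‖) := by
      have h4 : ‖x‖ ≤ ‖x - ρ • e‖ + |ρ| := by
        have := norm_add_le (x - ρ • e) (ρ • e)
        rwa [sub_add_cancel, norm_smul, he, mul_one, Real.norm_eq_abs] at this
      nlinarith [mul_nonneg (abs_nonneg ρ) (norm_nonneg (x - ρ • e))]
    calc ‖g x‖ * Real.exp (2 * Real.pi * z.im * ⟪x, e⟫)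
        ≤ ((1 + w x) * ((1 + ‖x‖) ^ n * Real.exp (-(b * ‖x‖ ^ 2)))) *
          Real.exp (2 * Real.pi * z.im * ⟪x, e⟫) := by gcongr; exact hg x
      _ = (1 + w x) * (1 + ‖x‖) ^ n * (Real.exp (-(b * ‖x‖ ^ 2)) *
          Real.exp (2 * Real.pi * z.im * ⟪x, e⟫)) := by ring
      _ ≤ (1 + w x) * ((1 + |ρ|) * (1 + ‖x - ρ • e‖)) ^ n *
          (Real.exp (b * ρ ^ 2) * Real.exp (-(b * ‖x - ρ • e‖ ^ 2))) := by
          have := hw0 x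
          rw [h2]; gcongr
      _ = ((1 + |ρ|) ^ n * Real.exp (b * ρ ^ 2)) *
          (k (x - ρ • e) + k (x - ρ • e) * w x) := by rw [mul_pow, hk]; ring
      _ ≤ _ := by
          have := hw0 x
          gcongr
          exact hkK _
  have hint : Integrable fun x => k (x - ρ • e) + K * w x :=
    (hki.comp_sub_right (ρ • e)).add (hw.const_mul K)
  calc ‖slice g y e z‖
      ≤ ∫ x, ((1 + |ρ|) ^ n * Real.exp (b * ρ ^ 2)) * (k (x - ρ • e) + K * w x) :=
        norm_integral_le_of_norm_le (hint.const_mul _) (Eventually.of_forall hpt)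
    _ = ((1 + |ρ|) ^ n * Real.exp (b * ρ ^ 2)) * ((∫ x, k x) + K * ∫ x, w x) := by
        rw [integral_const_mul, integral_add (hki.comp_sub_right (ρ • e)) (hw.const_mul K),
          integral_sub_right_eq_self k, integral_const_mul]
    _ ≤ (((1 + Real.pi / b) * (1 + |z.im|)) ^ n * Real.exp (Real.pi ^ 2 / b * z.im ^ 2)) *
        ((∫ x, k x) + K * ∫ x, w x) := by
        have e1 : b * ρ ^ 2 = Real.pi ^ 2 / b * z.im ^ 2 := by rw [hρ]; field_simp
        rw [e1]
        gcongr
        rw [hρ, abs_div, abs_mul, abs_of_pos Real.pi_pos, abs_of_pos hb]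
        have : 0 ≤ Real.pi / b := by have := Real.pi_pos; positivity
        have e2 : Real.pi * |z.im| / b = Real.pi / b * |z.im| := by ring
        rw [e2]
        nlinarith [abs_nonneg z.im]
    _ = _ := by rw [mul_pow]; ring

/-- Along a real line orthogonal to the base point, the Fourier transform times the inverse
Gaussian is a polynomial as soon as it has polynomial growth in the mean. -/
theorem exists_polynomial_fourier_line (hb : 0 < b) (hgm : AEStronglyMeasurable g volume)
    (hw : Integrable w) (hw0 : ∀ x, 0 ≤ w x)
    (hg : ∀ x, ‖g x‖ ≤ (1 + w x) * ((1 + ‖x‖) ^ n * Real.exp (-(b * ‖x‖ ^ 2))))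
    {y e : V} (he : ‖e‖ = 1) (hye : ⟪y, e⟫ = 0) {v : ℝ → ℝ} (hv : Integrable v)
    (hv0 : ∀ t, 0 ≤ v t) {A : ℝ} (hA : 0 ≤ A) {m : ℕ}
    (hr : ∀ t : ℝ, Real.exp (Real.pi ^ 2 / b * ‖y + t • e‖ ^ 2) * ‖𝓕 g (y + t • e)‖ ≤
      (1 + v t) * (A * (1 + |t|) ^ m)) :
    ∃ P : Polynomial ℂ, P.natDegree ≤ n + m + 1 ∧
      ∀ t : ℝ, Real.exp (Real.pi ^ 2 / b * ‖y + t • e‖ ^ 2) * 𝓕 g (y + t • e) = P.eval (t : ℂ) := by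
  obtain ⟨C, hC, hslice⟩ := exists_norm_slice_le hb hw hw0 hg
  set c : ℝ := Real.pi ^ 2 / b with hc
  have hc0 : 0 ≤ c := by positivity
  have hnorm : ∀ t : ℝ, ‖y + t • e‖ ^ 2 = ‖y‖ ^ 2 + t ^ 2 := fun t => by
    rw [norm_add_sq_real, inner_smul_right, hye, norm_smul, he]; simp
  have hreal : ∀ t : ℝ, cexp (c * (‖y‖ ^ 2 + (t : ℂ) ^ 2)) * slice g y e t =
      Real.exp (c * ‖y + t • e‖ ^ 2) * 𝓕 g (y + t • e) := fun t => by
    rw [slice_ofReal, hnorm]; push_cast; rfl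
  -- By orthogonality ‖y + te‖² = ‖y‖² + t², which extends holomorphically in t. The modulus of the
  -- extended inverse Gaussian contains exp(-c (Im z)²), which cancels the growth of `slice`.
  have key := exists_polynomial_of_growth
    (h := fun z => cexp (c * (‖y‖ ^ 2 + z ^ 2)) * slice g y e z)
    (C := Real.exp (c * ‖y‖ ^ 2) * C) (a := c) (A := A) (N := n) (n := m)
    (Differentiable.mul (by fun_prop) (differentiable_slice hb hgm hw hg y he)) hc0
    (fun z => ?_) hv hv0 hA (fun t => ?_)
  · obtain ⟨P, hP, hPe⟩ := key
    exact ⟨P, hP, fun t => by rw [← hPe, hreal]⟩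
  · have e1 : ‖cexp (c * (‖y‖ ^ 2 + z ^ 2))‖ =
        Real.exp (c * ‖y‖ ^ 2) * Real.exp (c * z.re ^ 2) * Real.exp (-(c * z.im ^ 2)) := by
      rw [Complex.norm_exp, ← Real.exp_add, ← Real.exp_add]
      congr 1
      simp [pow_two]
      ring
    rw [norm_mul, e1]
    calc _ ≤ Real.exp (c * ‖y‖ ^ 2) * Real.exp (c * z.re ^ 2) * Real.exp (-(c * z.im ^ 2)) *
          (C * (1 + |z.im|) ^ n * Real.exp (c * z.im ^ 2)) := by
          gcongr; exact hslice y e he z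
      _ = Real.exp (c * ‖y‖ ^ 2) * C * (1 + |z.im|) ^ n * Real.exp (c * z.re ^ 2) *
          (Real.exp (-(c * z.im ^ 2)) * Real.exp (c * z.im ^ 2)) := by ring
      _ = Real.exp (c * ‖y‖ ^ 2) * C * (1 + |z.im|) ^ n * Real.exp (c * z.re ^ 2) := by
          rw [← Real.exp_add]; simp
      _ ≤ _ := by
          gcongr
          exact Complex.abs_im_le_norm z
  · rw [hreal, norm_mul, Complex.norm_real, Real.norm_eq_abs, abs_of_pos (Real.exp_pos _)]
    exact hr t

end Slice

end CowlingPrice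

/-! ### From polynomials on almost every line to polynomials on the plane -/

namespace CowlingPrice

open Complex Set Filter Topology FourierTransform
open scoped RealInnerProductSpace

/-- Lagrange basis polynomial for the nodes `0, …, D`. -/
noncomputable def lagrangeNat (D i : ℕ) : Polynomial ℂ :=
  Lagrange.basis (Finset.range (D + 1)) (fun k : ℕ => (k : ℂ)) i

theorem eval_eq_sum_lagrangeNat {P : Polynomial ℂ} {D : ℕ} (hP : P.natDegree ≤ D) (z : ℂ) :
    P.eval z = ∑ i ∈ Finset.range (D + 1), P.eval (i : ℂ) * (lagrangeNat D i).eval z := by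
  have h := Lagrange.eq_interpolate (s := Finset.range (D + 1)) (v := fun k : ℕ => (k : ℂ))
    (f := P) (Nat.cast_injective.injOn) (by
      rw [Finset.card_range]
      exact lt_of_le_of_lt Polynomial.degree_le_natDegree
        (WithBot.coe_lt_coe.2 (Nat.lt_succ_of_le hP)))
  conv_lhs => rw [h]
  rw [Lagrange.interpolate_apply, Polynomial.eval_finsetSum]
  simp [lagrangeNat]

/-- Interpolation at the fixed nodes 0, …, D expresses the polynomial through values of γ that are
continuous in s, so the identity passes from almost every s to every s. -/
theorem eq_sum_lagrangeNat_of_ae {γ : ℝ → ℝ → ℂ} (hγ : ∀ t, Continuous fun s => γ s t) {D : ℕ}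
    (h : ∀ᵐ s, ∃ P : Polynomial ℂ, P.natDegree ≤ D ∧ ∀ t : ℝ, γ s t = P.eval (t : ℂ)) (s t : ℝ) :
    γ s t = ∑ i ∈ Finset.range (D + 1), γ s i * (lagrangeNat D i).eval (t : ℂ) := by
  have hc : Continuous fun s =>
      ∑ i ∈ Finset.range (D + 1), γ s i * (lagrangeNat D i).eval (t : ℂ) :=
    continuous_finsetSum _ fun i _ => (hγ i).mul continuous_const
  refine congrFun (((hγ t).ae_eq_iff_eq volume hc).1 ?_) s
  filter_upwards [h] with s hs
  obtain ⟨P, hP, hPe⟩ := hs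
  rw [hPe, eval_eq_sum_lagrangeNat hP]
  refine Finset.sum_congr rfl fun i _ => ?_
  rw [hPe]; simp

theorem eval_aeval_X (x : Fin 2 → ℂ) (k : Fin 2) (p : Polynomial ℂ) :
    MvPolynomial.eval x (Polynomial.aeval (MvPolynomial.X k) p) = p.eval (x k) := by
  rw [← MvPolynomial.coe_aeval_eq_eval, RingHom.coe_coe, ← Polynomial.aeval_algHom_apply]
  simp

/-- A continuous function of two real variables which is a polynomial of bounded degree on almost
every coordinate line is a polynomial. -/
theorem exists_mvPolynomial_of_ae {γ : ℝ → ℝ → ℂ} (h1 : ∀ t, Continuous fun s => γ s t)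
    (h2 : ∀ s, Continuous fun t => γ s t) {D : ℕ}
    (hs : ∀ᵐ s, ∃ P : Polynomial ℂ, P.natDegree ≤ D ∧ ∀ t : ℝ, γ s t = P.eval (t : ℂ))
    (ht : ∀ᵐ t, ∃ P : Polynomial ℂ, P.natDegree ≤ D ∧ ∀ s : ℝ, γ s t = P.eval (s : ℂ)) :
    ∃ Q : MvPolynomial (Fin 2) ℂ, ∀ s t : ℝ, γ s t = MvPolynomial.eval ![(s : ℂ), t] Q := by
  -- Interpolation in t, then in s at each node t = i.
  refine ⟨∑ i ∈ Finset.range (D + 1), (∑ j ∈ Finset.range (D + 1),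
    MvPolynomial.C (γ j i) * Polynomial.aeval (MvPolynomial.X 0) (lagrangeNat D j)) *
      Polynomial.aeval (MvPolynomial.X 1) (lagrangeNat D i), fun s t => ?_⟩
  rw [eq_sum_lagrangeNat_of_ae h1 hs s t, map_sum]
  refine Finset.sum_congr rfl fun i _ => ?_
  rw [map_mul, map_sum, eval_aeval_X, eq_sum_lagrangeNat_of_ae (γ := fun t s => γ s t) h2 ht i s]
  simp [eval_aeval_X]

theorem measurePreserving_plane :
    MeasurePreserving (fun p : ℝ × ℝ => (!₂[p.1, p.2] : QFT.Plane)) := by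
  have := (PiLp.volume_preserving_toLp (Fin 2)).comp (volume_preserving_finTwoArrow ℝ).symm
  exact this

theorem measurePreserving_plane_swap :
    MeasurePreserving (fun p : ℝ × ℝ => (!₂[p.2, p.1] : QFT.Plane)) := by
  exact measurePreserving_plane.comp Measure.measurePreserving_swap

theorem norm_plane_sq (s t : ℝ) : ‖(!₂[s, t] : QFT.Plane)‖ ^ 2 = s ^ 2 + t ^ 2 := by
  rw [EuclideanSpace.norm_sq_eq]; simp

/-- The product form keeps the weight polynomial in t on each line s = const, with constant (1 +
|s|)^m. -/
theorem one_add_norm_plane_le (s t : ℝ) :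
    1 + ‖(!₂[s, t] : QFT.Plane)‖ ≤ (1 + |s|) * (1 + |t|) := by
  have h : ‖(!₂[s, t] : QFT.Plane)‖ ≤ |s| + |t| := by
    refine abs_le_of_sq_le_sq' ?_ (by positivity) |>.2
    rw [norm_plane_sq, ← sq_abs s, ← sq_abs t]
    nlinarith [mul_nonneg (abs_nonneg s) (abs_nonneg t)]
  nlinarith [mul_nonneg (abs_nonneg s) (abs_nonneg t)]

theorem continuous_plane : Continuous fun p : ℝ × ℝ => (!₂[p.1, p.2] : QFT.Plane) := by
  refine (PiLp.continuous_toLp 2 _).comp (continuous_pi fun i => ?_)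
  fin_cases i
  · exact continuous_fst
  · exact continuous_snd

theorem norm_plane_zero_one : ‖(!₂[0, 1] : QFT.Plane)‖ = 1 := by
  rw [← pow_left_inj₀ (norm_nonneg _) zero_le_one two_ne_zero, norm_plane_sq]; norm_num

theorem norm_plane_one_zero : ‖(!₂[1, 0] : QFT.Plane)‖ = 1 := by
  rw [← pow_left_inj₀ (norm_nonneg _) zero_le_one two_ne_zero, norm_plane_sq]; norm_num

theorem plane_add_smul_zero_one (s t : ℝ) :
    (!₂[s, 0] : QFT.Plane) + t • !₂[0, 1] = !₂[s, t] := by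
  ext i; fin_cases i <;> simp

theorem plane_add_smul_one_zero (s t : ℝ) :
    (!₂[0, t] : QFT.Plane) + s • !₂[1, 0] = !₂[s, t] := by
  ext i; fin_cases i <;> simp

theorem plane_eta (ξ : QFT.Plane) : (!₂[ξ 0, ξ 1] : QFT.Plane) = ξ := by
  ext i; fin_cases i <;> simp

theorem exists_mvPolynomial_of_ae_lines {G : QFT.Plane → ℂ} (hG : Continuous G) {D : ℕ}
    (hs : ∀ᵐ s : ℝ, ∃ P : Polynomial ℂ, P.natDegree ≤ D ∧
      ∀ t : ℝ, G (!₂[s, 0] + t • !₂[0, 1]) = P.eval (t : ℂ))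
    (ht : ∀ᵐ t : ℝ, ∃ P : Polynomial ℂ, P.natDegree ≤ D ∧
      ∀ s : ℝ, G (!₂[0, t] + s • !₂[1, 0]) = P.eval (s : ℂ)) :
    ∃ Q : MvPolynomial (Fin 2) ℂ, ∀ ξ : QFT.Plane,
      G ξ = MvPolynomial.eval ![(ξ 0 : ℂ), ξ 1] Q := by
  simp only [plane_add_smul_zero_one] at hs
  simp only [plane_add_smul_one_zero] at ht
  have hc := hG.comp continuous_plane
  obtain ⟨Q, hQ⟩ := exists_mvPolynomial_of_ae (γ := fun s t => G !₂[s, t]) (D := D)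
    (fun t => hc.comp (by fun_prop : Continuous fun s : ℝ => (s, t)))
    (fun s => hc.comp (by fun_prop : Continuous fun t : ℝ => (s, t))) hs ht
  exact ⟨Q, fun ξ => by rw [← hQ, plane_eta]⟩

section Plane

variable {g : QFT.Plane → ℂ} {b : ℝ} {w v : QFT.Plane → ℝ} {n m : ℕ}

theorem exists_polynomial_fourier_plane_line (hb : 0 < b)
    (hgm : AEStronglyMeasurable g volume)
    (hw : Integrable w) (hw0 : ∀ x, 0 ≤ w x) (hv0 : ∀ x, 0 ≤ v x)
    (hg : ∀ x, ‖g x‖ ≤ (1 + w x) * ((1 + ‖x‖) ^ n * Real.exp (-(b * ‖x‖ ^ 2))))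
    (hgf : ∀ ξ, Real.exp (Real.pi ^ 2 / b * ‖ξ‖ ^ 2) * ‖𝓕 g ξ‖ ≤ (1 + v ξ) * (1 + ‖ξ‖) ^ m)
    {y e : QFT.Plane} (he : ‖e‖ = 1) (hye : ⟪y, e⟫ = 0) {s : ℝ}
    (hn : ∀ t : ℝ, 1 + ‖y + t • e‖ ≤ (1 + |s|) * (1 + |t|))
    (hvi : Integrable fun t : ℝ => v (y + t • e)) :
    ∃ P : Polynomial ℂ, P.natDegree ≤ n + m + 1 ∧
      ∀ t : ℝ, Real.exp (Real.pi ^ 2 / b * ‖y + t • e‖ ^ 2) * 𝓕 g (y + t • e) =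
        P.eval (t : ℂ) := by
  refine exists_polynomial_fourier_line hb hgm hw hw0 hg he hye hvi (fun t => hv0 _)
    (A := (1 + |s|) ^ m) (by positivity) fun t => (hgf _).trans ?_
  rw [← mul_pow]
  have := hv0 (y + t • e)
  gcongr
  exact hn t

/-- If `g` and its Fourier transform are, in the mean, bounded by polynomials times a Gaussian and
the dual Gaussian, then the Fourier transform is a polynomial times a Gaussian. -/
theorem exists_mvPolynomial_fourier_eq (hb : 0 < b) (hgm : AEStronglyMeasurable g volume)
    (hw : Integrable w) (hw0 : ∀ x, 0 ≤ w x) (hv : Integrable v) (hv0 : ∀ x, 0 ≤ v x)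
    (hg : ∀ x, ‖g x‖ ≤ (1 + w x) * ((1 + ‖x‖) ^ n * Real.exp (-(b * ‖x‖ ^ 2))))
    (hgf : ∀ ξ, Real.exp (Real.pi ^ 2 / b * ‖ξ‖ ^ 2) * ‖𝓕 g ξ‖ ≤ (1 + v ξ) * (1 + ‖ξ‖) ^ m) :
    ∃ Q : MvPolynomial (Fin 2) ℂ, ∀ ξ : QFT.Plane,
      Real.exp (Real.pi ^ 2 / b * ‖ξ‖ ^ 2) * 𝓕 g ξ =
        MvPolynomial.eval ![(ξ 0 : ℂ), ξ 1] Q := by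
  have hline := fun {y e : QFT.Plane} => exists_polynomial_fourier_plane_line hb hgm hw hw0 hv0 hg
    hgf (y := y) (e := e)
  have hFc : Continuous (𝓕 g) :=
    VectorFourier.fourierIntegral_continuous Real.continuous_fourierChar continuous_inner
      (integrable_of_gaussian_bound hb hgm hw hg)
  have hGc : Continuous fun ξ => (Real.exp (Real.pi ^ 2 / b * ‖ξ‖ ^ 2) : ℂ) * 𝓕 g ξ :=
    Continuous.mul (by fun_prop) hFc
  refine exists_mvPolynomial_of_ae_lines (D := n + m + 1) hGc ?_ ?_
  -- Fubini: `v` is integrable on almost every line parallel to an axis.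
  · have := (measurePreserving_plane.integrable_comp_of_integrable hv).prod_right_ae
    filter_upwards [this] with s hs
    refine hline (s := s) norm_plane_zero_one (by simp [PiLp.inner_apply]) (fun t => ?_) ?_
    · rw [plane_add_smul_zero_one]; exact one_add_norm_plane_le s t
    · simp only [plane_add_smul_zero_one]; exact hs
  · have := (measurePreserving_plane_swap.integrable_comp_of_integrable hv).prod_right_ae
    filter_upwards [this] with t ht
    refine hline (s := t) norm_plane_one_zero (by simp [PiLp.inner_apply]) (fun s => ?_) ?_
    · rw [plane_add_smul_one_zero, mul_comm]; exact one_add_norm_plane_le s t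
    · simp only [plane_add_smul_one_zero]; exact ht

end Plane

end CowlingPrice

/-! ### Injectivity of the Fourier transform, and Gaussians times powers -/

namespace CowlingPrice

open Complex Set Filter Topology FourierTransform
open scoped RealInnerProductSpace ContDiff SchwartzMap

section Uniqueness

variable {V : Type*} [NormedAddCommGroup V] [InnerProductSpace ℝ V] [FiniteDimensional ℝ V]
  [MeasurableSpace V] [BorelSpace V]

/-- Injectivity of the Fourier transform on `L¹`. -/
theorem ae_eq_zero_of_fourier_eq_zero {u : V → ℂ} (hu : Integrable u) (h : 𝓕 u = 0) :
    u =ᵐ[volume] 0 := by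
  refine ae_eq_zero_of_integral_contDiff_smul_eq_zero hu.locallyIntegrable fun φ hφ hφs => ?_
  have h2 : HasCompactSupport (Complex.ofRealCLM ∘ φ) := hφs.comp_left rfl
  set Φ : 𝓢(V, ℂ) := h2.toSchwartzMap (Complex.ofRealCLM.contDiff.comp hφ) with hΦ
  -- The multiplication formula for 𝓕⁻Φ and u: ∫ φu = ∫ (𝓕⁻Φ)(𝓕u) = 0 for every test function φ.
  have h3 := VectorFourier.integral_fourierIntegral_smul_eq_flip (μ := volume) (ν := volume)
    (f := (𝓕⁻ Φ : 𝓢(V, ℂ))) (g := u) (L := innerₗ V) Real.continuous_fourierChar continuous_inner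
    (𝓕⁻ Φ : 𝓢(V, ℂ)).integrable hu
  have h4 : (innerₗ V).flip = innerₗ V := by ext; simp
  rw [h4] at h3
  have h5 : VectorFourier.fourierIntegral Real.fourierChar volume (innerₗ V) u = 0 := h
  have h6 : ∀ x, VectorFourier.fourierIntegral Real.fourierChar volume (innerₗ V)
      (𝓕⁻ Φ : 𝓢(V, ℂ)) x = φ x := by
    intro x
    have h7 : (𝓕 (𝓕⁻ Φ) : 𝓢(V, ℂ)) x = Φ x := by
      rw [FourierTransform.fourier_fourierInv_eq]
    rw [SchwartzMap.fourier_coe] at h7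
    exact h7
  simp only [h5, h6, Pi.zero_apply, smul_zero, integral_zero] at h3
  simpa using h3

theorem ae_eq_of_fourier_eq {u v : V → ℂ} (hu : Integrable u) (hv : Integrable v)
    (h : 𝓕 u = 𝓕 v) : u =ᵐ[volume] v := by
  have : 𝓕 (u - v) = 0 := by
    have h1 : 𝓕 (u - v) = 𝓕 u - 𝓕 v := by
      ext x
      simp only [Real.fourier_eq, Pi.sub_apply, smul_sub]
      exact integral_sub ((Real.fourierIntegral_convergent_iff x).2 hu)
        ((Real.fourierIntegral_convergent_iff x).2 hv)
    rw [h1, h, sub_self]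
  have h2 := ae_eq_zero_of_fourier_eq_zero (hu.sub hv) this
  filter_upwards [h2] with x hx
  exact sub_eq_zero.1 hx

end Uniqueness

theorem integrable_pow_mul_gaussian {c : ℝ} (hc : 0 < c) (n : ℕ) :
    Integrable fun y : ℝ => (y : ℂ) ^ n * (Real.exp (-(c * y ^ 2)) : ℂ) := by
  have := integrable_weight (V := ℝ) hc n 0
  refine this.mono' (Continuous.aestronglyMeasurable (by fun_prop))
    (Eventually.of_forall fun y => ?_)
  rw [norm_mul, norm_pow, Complex.norm_real, Complex.norm_real, Real.norm_eq_abs,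
    Real.norm_eq_abs, abs_of_pos (Real.exp_pos _)]
  simp only [zero_mul, Real.exp_zero, mul_one, sq_abs]
  gcongr
  linarith

/-- Multiplication by -2πiy becomes differentiation of the transform. With d = π²/c, the derivative
of p exp(-dx²) is (p' - 2dxp) exp(-dx²), which raises the degree by at most one. -/
theorem exists_polynomial_fourier_pow_mul_gaussian {c : ℝ} (hc : 0 < c) (n : ℕ) :
    ∃ p : Polynomial ℂ, p.natDegree ≤ n ∧ ∀ x : ℝ,
      𝓕 (fun y : ℝ => (y : ℂ) ^ n * (Real.exp (-(c * y ^ 2)) : ℂ)) x =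
        p.eval (x : ℂ) * Real.exp (-(Real.pi ^ 2 / c * x ^ 2)) := by
  induction n with
  | zero =>
    refine ⟨Polynomial.C ((Real.pi / c : ℂ) ^ (1 / 2 : ℂ)), by simp, fun x => ?_⟩
    have := fourier_gaussian_innerProductSpace (V := ℝ) (b := (c : ℂ)) (by simpa using hc) x
    simp only [pow_zero, one_mul, Polynomial.eval_C]
    convert this using 2
    · ext y; push_cast; congr 1; simp [← ofReal_pow]
    · simp
    · push_cast; congr 1; simp [← ofReal_pow]; ring
  | succ n ih =>
    obtain ⟨p, hp, hpe⟩ := ih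
    set d : ℂ := Real.pi ^ 2 / c
    refine ⟨Polynomial.C ((-2 * Real.pi * I)⁻¹) *
      (p.derivative - Polynomial.C (2 * d) * (Polynomial.X * p)), ?_, fun x => ?_⟩
    · refine (Polynomial.natDegree_C_mul_le _ _).trans ?_
      refine (Polynomial.natDegree_sub_le _ _).trans (max_le ?_ ?_)
      · exact (p.natDegree_derivative_le.trans (Nat.sub_le _ _)).trans (hp.trans n.le_succ)
      · refine (Polynomial.natDegree_C_mul_le _ _).trans (Polynomial.natDegree_mul_le.trans ?_)
        rw [Polynomial.natDegree_X]; omega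
    · have h1 := Real.hasDerivAt_fourier (integrable_pow_mul_gaussian hc n)
        ((integrable_pow_mul_gaussian hc (n + 1)).congr (Eventually.of_forall fun y => by
          simp only [Complex.real_smul]; ring)) x
      have h2 : HasDerivAt (fun x : ℝ => p.eval (x : ℂ) * Real.exp (-(Real.pi ^ 2 / c * x ^ 2)))
          ((p.derivative - Polynomial.C (2 * d) * (Polynomial.X * p)).eval (x : ℂ) *
            Real.exp (-(Real.pi ^ 2 / c * x ^ 2))) x := by
        have e1 : HasDerivAt (fun z : ℂ => p.eval z * cexp (-(d * z ^ 2)))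
            ((p.derivative - Polynomial.C (2 * d) * (Polynomial.X * p)).eval (x : ℂ) *
              cexp (-(d * (x : ℂ) ^ 2))) x := by
          have e2 : HasDerivAt (fun z : ℂ => -(d * z ^ 2)) (-(d * (2 * x))) (x : ℂ) := by
            have := ((hasDerivAt_pow 2 (x : ℂ)).const_mul d).fun_neg
            simpa using this
          refine ((p.hasDerivAt (x : ℂ)).mul e2.cexp).congr_deriv ?_
          simp; ring
        have e3 := e1.comp_ofReal
        convert e3 using 1
        · ext y; push_cast; rfl
        · push_cast; rfl
      have h3 : 𝓕 (fun y : ℝ => (y : ℂ) ^ n * (Real.exp (-(c * y ^ 2)) : ℂ)) =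
          fun x : ℝ => p.eval (x : ℂ) * Real.exp (-(Real.pi ^ 2 / c * x ^ 2)) := funext hpe
      rw [h3] at h1
      have h4 := h1.unique h2
      have h5 : 𝓕 (fun y : ℝ => (-2 * Real.pi * I * y) •
          ((y : ℂ) ^ n * (Real.exp (-(c * y ^ 2)) : ℂ))) x = (-2 * Real.pi * I) *
          𝓕 (fun y : ℝ => (y : ℂ) ^ (n + 1) * (Real.exp (-(c * y ^ 2)) : ℂ)) x := by
        rw [Real.fourier_eq', Real.fourier_eq', ← integral_const_mul]
        congr 1; ext y
        simp only [smul_eq_mul]; ring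
      rw [h5] at h4
      have h6 : (-2 * Real.pi * I : ℂ) ≠ 0 := by simp [Real.pi_ne_zero, I_ne_zero]
      rw [Polynomial.eval_mul, Polynomial.eval_C, mul_assoc, ← h4, inv_mul_cancel_left₀ h6]

end CowlingPrice

/-! ### Fourier inversion of a polynomial times a Gaussian in the plane -/

namespace CowlingPrice

open Complex Set Filter Topology FourierTransform
open scoped RealInnerProductSpace

theorem totalDegree_aeval_X_le (p : Polynomial ℂ) (i : Fin 2) :
    (Polynomial.aeval (MvPolynomial.X i : MvPolynomial (Fin 2) ℂ) p).totalDegree ≤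
      p.natDegree := by
  rw [Polynomial.aeval_eq_sum_range]
  refine MvPolynomial.totalDegree_finsetSum_le fun k hk => ?_
  refine (MvPolynomial.totalDegree_smul_le _ _).trans ?_
  rw [MvPolynomial.totalDegree_X_pow]
  exact Nat.lt_succ_iff.1 (Finset.mem_range.1 hk)

theorem fourier_plane_mul (u v : ℝ → ℂ) (x : QFT.Plane) :
    𝓕 (fun ξ : QFT.Plane => u (ξ 0) * v (ξ 1)) x = 𝓕 u (x 0) * 𝓕 v (x 1) := by
  have h : MeasurePreserving
      ((MeasurableEquiv.finTwoArrow (α := ℝ)).symm.trans (MeasurableEquiv.toLp 2 (Fin 2 → ℝ))) :=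
    measurePreserving_plane
  rw [Real.fourier_eq', Real.fourier_eq', Real.fourier_eq', ← integral_prod_mul,
    ← h.integral_comp']
  refine integral_congr_ae (Eventually.of_forall fun p => ?_)
  change cexp (↑(-2 * Real.pi * ⟪(!₂[p.1, p.2] : QFT.Plane), x⟫) * I) • (u p.1 * v p.2) = _
  have : (⟪(!₂[p.1, p.2] : QFT.Plane), x⟫ : ℝ) = ⟪p.1, x 0⟫ + ⟪p.2, x 1⟫ := by
    simp [PiLp.inner_apply]
  rw [this, mul_add, ofReal_add, add_mul, Complex.exp_add]
  simp only [smul_eq_mul]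
  ring

theorem norm_sq_plane (ξ : QFT.Plane) : ‖ξ‖ ^ 2 = ξ 0 ^ 2 + ξ 1 ^ 2 := by
  rw [← norm_plane_sq, plane_eta]

theorem fourier_monomial_mul_gaussian {c : ℝ} (hc : 0 < c) (k l : ℕ) :
    ∃ p q : Polynomial ℂ, p.natDegree ≤ k ∧ q.natDegree ≤ l ∧ ∀ x : QFT.Plane,
      𝓕 (fun ξ : QFT.Plane => (ξ 0 : ℂ) ^ k * (ξ 1 : ℂ) ^ l * Real.exp (-(c * ‖ξ‖ ^ 2))) x =
        p.eval (x 0 : ℂ) * q.eval (x 1 : ℂ) * Real.exp (-(Real.pi ^ 2 / c * ‖x‖ ^ 2)) := by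
  obtain ⟨p, hp, hpe⟩ := exists_polynomial_fourier_pow_mul_gaussian hc k
  obtain ⟨q, hq, hqe⟩ := exists_polynomial_fourier_pow_mul_gaussian hc l
  refine ⟨p, q, hp, hq, fun x => ?_⟩
  have e : ∀ (a : ℝ) (ξ : QFT.Plane), (Real.exp (-(a * ‖ξ‖ ^ 2)) : ℂ) =
      Real.exp (-(a * ξ 0 ^ 2)) * Real.exp (-(a * ξ 1 ^ 2)) := fun a ξ => by
    rw [← ofReal_mul, ← Real.exp_add, norm_sq_plane]; ring_nf
  have h := fourier_plane_mul (fun y : ℝ => (y : ℂ) ^ k * (Real.exp (-(c * y ^ 2)) : ℂ))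
    (fun y : ℝ => (y : ℂ) ^ l * (Real.exp (-(c * y ^ 2)) : ℂ)) x
  rw [hpe, hqe] at h
  rw [e]
  calc _ = _ := by
        refine congrFun (congrArg _ (funext fun ξ => ?_)) x
        rw [e]; exact mul_mul_mul_comm _ _ _ _
    _ = _ := h
    _ = _ := by ring

theorem integrable_monomial_mul_gaussian {c : ℝ} (hc : 0 < c) (k l : ℕ) :
    Integrable fun ξ : QFT.Plane => (ξ 0 : ℂ) ^ k * (ξ 1 : ℂ) ^ l * Real.exp (-(c * ‖ξ‖ ^ 2)) := by
  have := integrable_weight (V := QFT.Plane) hc (k + l) 0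
  refine this.mono' (Continuous.aestronglyMeasurable (by fun_prop))
    (Eventually.of_forall fun ξ => ?_)
  have h : ∀ i, |ξ i| ≤ 1 + ‖ξ‖ := fun i => by
    have := PiLp.norm_apply_le ξ i
    rw [Real.norm_eq_abs] at this
    linarith
  rw [norm_mul, norm_mul, norm_pow, norm_pow, Complex.norm_real, Complex.norm_real,
    Complex.norm_real, Real.norm_eq_abs, Real.norm_eq_abs, Real.norm_eq_abs,
    abs_of_pos (Real.exp_pos _), pow_add, zero_mul, Real.exp_zero, mul_one]
  gcongr
  · exact h 0
  · exact h 1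

theorem eval_mul_gaussian_eq_sum (Q : MvPolynomial (Fin 2) ℂ) (x : Fin 2 → ℂ) (a : ℂ) :
    MvPolynomial.eval x Q * a =
      ∑ d ∈ Q.support, Q.coeff d * (x 0 ^ d 0 * x 1 ^ d 1 * a) := by
  rw [MvPolynomial.eval_eq', Finset.sum_mul]
  refine Finset.sum_congr rfl fun d _ => ?_
  rw [Fin.prod_univ_two]; ring

theorem integrable_eval_mul_gaussian {c : ℝ} (hc : 0 < c) (Q : MvPolynomial (Fin 2) ℂ) :
    Integrable fun ξ : QFT.Plane =>
      MvPolynomial.eval ![(ξ 0 : ℂ), ξ 1] Q * (Real.exp (-(c * ‖ξ‖ ^ 2)) : ℂ) := by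
  simp_rw [eval_mul_gaussian_eq_sum]
  exact integrable_finsetSum _ fun d _ =>
    (integrable_monomial_mul_gaussian hc (d 0) (d 1)).const_mul _

/-- By linearity this reduces to monomials, whose transforms factor over the coordinates. The clause
on Q = 0 is kept because `totalDegree` does not distinguish 0 from nonzero constants. -/
theorem exists_fourierInv_eval_mul_gaussian {c : ℝ} (hc : 0 < c) (Q : MvPolynomial (Fin 2) ℂ) :
    ∃ P : MvPolynomial (Fin 2) ℂ, P.totalDegree ≤ Q.totalDegree ∧ (Q = 0 → P = 0) ∧
      ∀ x : QFT.Plane, 𝓕⁻ (fun ξ : QFT.Plane =>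
        MvPolynomial.eval ![(ξ 0 : ℂ), ξ 1] Q * (Real.exp (-(c * ‖ξ‖ ^ 2)) : ℂ)) x =
        MvPolynomial.eval ![(x 0 : ℂ), x 1] P * Real.exp (-(Real.pi ^ 2 / c * ‖x‖ ^ 2)) := by
  choose p q hp hq hpq using fun d : Fin 2 →₀ ℕ => fourier_monomial_mul_gaussian hc (d 0) (d 1)
  -- The inverse transform at x is the transform at -x, hence the composition with -X.
  refine ⟨∑ d ∈ Q.support, MvPolynomial.C (Q.coeff d) *
    (Polynomial.aeval (MvPolynomial.X 0) ((p d).comp (-Polynomial.X)) *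
      Polynomial.aeval (MvPolynomial.X 1) ((q d).comp (-Polynomial.X))), ?_, ?_, fun x => ?_⟩
  · refine MvPolynomial.totalDegree_finsetSum_le fun d hd => ?_
    refine (MvPolynomial.totalDegree_mul _ _).trans ?_
    rw [MvPolynomial.totalDegree_C, zero_add]
    refine (MvPolynomial.totalDegree_mul _ _).trans ?_
    have hcomp : ∀ r : Polynomial ℂ, (r.comp (-Polynomial.X)).natDegree ≤ r.natDegree :=
      fun r => Polynomial.natDegree_comp_le.trans (by simp)
    have h1 := (totalDegree_aeval_X_le ((p d).comp (-Polynomial.X)) 0).trans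
      ((hcomp _).trans (hp d))
    have h2 := (totalDegree_aeval_X_le ((q d).comp (-Polynomial.X)) 1).trans
      ((hcomp _).trans (hq d))
    have h3 := MvPolynomial.le_totalDegree hd
    rw [Finsupp.sum_fintype _ _ (fun _ => rfl), Fin.sum_univ_two] at h3
    omega
  · rintro rfl; simp
  · rw [Real.fourierInv_eq_fourier_neg, Real.fourier_eq]
    simp_rw [eval_mul_gaussian_eq_sum Q, Finset.smul_sum]
    rw [integral_finsetSum]
    · rw [map_sum, Finset.sum_mul]
      refine Finset.sum_congr rfl fun d _ => ?_
      have h1 := hpq d (-x)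
      rw [Real.fourier_eq] at h1
      have h2 : ∀ (z : Circle) (b : ℂ), z • (Q.coeff d * b) = Q.coeff d * (z • b) := fun z b => by
        simp only [Circle.smul_def, smul_eq_mul]; ring
      simp_rw [h2]
      rw [integral_const_mul]
      simp only [Matrix.cons_val_zero, Matrix.cons_val_one]
      rw [h1]
      simp [eval_aeval_X]
      ring
    · intro d _
      exact (Real.fourierIntegral_convergent_iff (-x)).2
        ((integrable_monomial_mul_gaussian hc (d 0) (d 1)).const_mul _)

/-- A function whose Fourier transform is a polynomial times a Gaussian is a polynomial, of no
larger degree, times the dual Gaussian. -/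
theorem exists_ae_eq_eval_mul_gaussian {g : QFT.Plane → ℂ} (hg : Integrable g) {c : ℝ}
    (hc : 0 < c) {Q : MvPolynomial (Fin 2) ℂ}
    (h : ∀ ξ : QFT.Plane, 𝓕 g ξ =
      MvPolynomial.eval ![(ξ 0 : ℂ), ξ 1] Q * (Real.exp (-(c * ‖ξ‖ ^ 2)) : ℂ)) :
    ∃ P : MvPolynomial (Fin 2) ℂ, P.totalDegree ≤ Q.totalDegree ∧ (Q = 0 → P = 0) ∧
      g =ᵐ[volume] fun x : QFT.Plane =>
        MvPolynomial.eval ![(x 0 : ℂ), x 1] P * Real.exp (-(Real.pi ^ 2 / c * ‖x‖ ^ 2)) := by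
  obtain ⟨P, hP, hP0, hPe⟩ := exists_fourierInv_eval_mul_gaussian hc Q
  refine ⟨P, hP, hP0, ?_⟩
  have hπ : 0 < Real.pi ^ 2 / c := by have := Real.pi_pos; positivity
  have hi := integrable_eval_mul_gaussian hπ P
  refine ae_eq_of_fourier_eq hg hi ?_
  rw [← funext hPe, ← funext h]
  have hFc : Continuous (𝓕 g) :=
    VectorFourier.fourierIntegral_continuous Real.continuous_fourierChar continuous_inner hg
  have h1 : 𝓕⁻ (𝓕 g) = fun x : QFT.Plane =>
      MvPolynomial.eval ![(x 0 : ℂ), x 1] P * (Real.exp (-(Real.pi ^ 2 / c * ‖x‖ ^ 2)) : ℂ) := by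
    rw [funext h]; exact funext hPe
  have h2 : Integrable (𝓕 g) := by rw [funext h]; exact integrable_eval_mul_gaussian hc Q
  -- Inversion applied to 𝓕 g. Its own transform is the reflection of 𝓕⁻(𝓕 g), an integrable
  -- polynomial times a Gaussian.
  refine (hFc.fourier_fourierInv_eq h2 ?_).symm
  have h3 : Integrable (𝓕⁻ (𝓕 g)) := h1 ▸ hi
  have h4 : 𝓕 (𝓕 g) = fun x => 𝓕⁻ (𝓕 g) (-x) := by
    ext x; rw [Real.fourierInv_eq_fourier_neg, neg_neg]
  rw [h4]
  exact h3.comp_neg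

end CowlingPrice

/-! ### Degree bounds from weighted integrability -/

namespace CowlingPrice

open Set Filter Topology

section Degree

variable {𝕜 : Type*} [RCLike 𝕜]

theorem eval_mul_of_isHomogeneous {φ : MvPolynomial (Fin 2) 𝕜} {n : ℕ} (hφ : φ.IsHomogeneous n)
    (r : 𝕜) (x : Fin 2 → 𝕜) :
    MvPolynomial.eval (fun i => r * x i) φ = r ^ n * MvPolynomial.eval x φ := by
  rw [MvPolynomial.eval_eq', MvPolynomial.eval_eq', Finset.mul_sum]
  refine Finset.sum_congr rfl fun d hd => ?_
  have h := hφ (MvPolynomial.mem_support_iff.1 hd)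
  rw [Finsupp.weight_apply, Finsupp.sum_fintype _ _ (fun _ => by simp), Fin.sum_univ_two] at h
  simp only [Pi.one_apply, smul_eq_mul, mul_one] at h
  rw [Fin.prod_univ_two, Fin.prod_univ_two, ← h]
  ring

theorem exists_real_eval_ne_zero {P : MvPolynomial (Fin 2) 𝕜} (hP : P ≠ 0) :
    ∃ x : QFT.Plane, x ≠ 0 ∧ MvPolynomial.eval (fun i => (x i : 𝕜)) P ≠ 0 := by
  by_contra! hcon
  -- The product with X₀ vanishes at the origin too, so it vanishes at all real points.
  refine mul_ne_zero hP (MvPolynomial.X_ne_zero (0 : Fin 2)) (MvPolynomial.funext_set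
    (fun _ => range ((↑) : ℝ → 𝕜))
    (fun _ => infinite_range_of_injective RCLike.ofReal_injective) fun y hy => ?_)
  choose x hx using fun i => hy i (mem_univ i)
  have hxy : y = fun i => ((WithLp.toLp 2 x : QFT.Plane) i : 𝕜) := by
    ext i; exact (hx i).symm
  rw [map_mul, MvPolynomial.eval_X, map_zero]
  by_cases h0 : (WithLp.toLp 2 x : QFT.Plane) = 0
  · rw [hxy, h0]; simp
  · rw [hxy, hcon _ h0, zero_mul]

/-- The quotient P(rx)/r^n is the sum of r^{-(n-k)} P_k(x) over the homogeneous components P_k. It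
is continuous in (1/r, x) up to 1/r = 0, where it equals P_n(x). Near a real point x₀ with P_n(x₀) ≠
0 it stays above half of |P_n(x₀)|. The condition 2ε ≤ ‖x₀‖ makes the dilated balls escape to
infinity. -/
theorem exists_le_norm_eval_smul {P : MvPolynomial (Fin 2) 𝕜} (hP : P ≠ 0) :
    ∃ (x₀ : QFT.Plane) (ε c R : ℝ), 0 < ε ∧ 0 < c ∧ 2 * ε ≤ ‖x₀‖ ∧
      ∀ r : ℝ, R ≤ r → ∀ x ∈ Metric.ball x₀ ε,
        c * r ^ P.totalDegree ≤ ‖MvPolynomial.eval (fun i => ((r • x) i : 𝕜)) P‖ := by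
  set n := P.totalDegree with hn
  have htop : MvPolynomial.homogeneousComponent n P ≠ 0 := by
    intro h
    obtain ⟨d, hd, hdn⟩ : ∃ d ∈ P.support, d.sum (fun _ e => e) = n := by
      obtain ⟨d, hd, h1⟩ := Finset.exists_mem_eq_sup P.support
        (MvPolynomial.support_nonempty.2 hP) (fun s => s.sum fun _ e => e)
      exact ⟨d, hd, h1.symm⟩
    have h2 := congrArg (MvPolynomial.coeff d) h
    rw [MvPolynomial.coeff_homogeneousComponent, if_pos (by rw [← hdn]; rfl)] at h2
    exact MvPolynomial.mem_support_iff.1 hd h2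
  obtain ⟨x₀, hx₀, hne⟩ := exists_real_eval_ne_zero htop
  set φ : ℝ × QFT.Plane → 𝕜 := fun q => ∑ k ∈ Finset.range (n + 1),
    (q.1 : 𝕜) ^ (n - k) *
      MvPolynomial.eval (fun i => (q.2 i : 𝕜)) (MvPolynomial.homogeneousComponent k P) with hφ
  have hφc : Continuous φ := by
    refine continuous_finsetSum _ fun k _ => ?_
    refine Continuous.mul (by fun_prop) ((MvPolynomial.continuous_eval _).comp ?_)
    fun_prop
  have hφ0 : φ (0, x₀) = MvPolynomial.eval (fun i => (x₀ i : 𝕜))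
      (MvPolynomial.homogeneousComponent n P) := by
    simp only [hφ]
    rw [Finset.sum_range_succ, Finset.sum_eq_zero]
    · simp
    · intro k hk
      have : n - k ≠ 0 := by have := Finset.mem_range.1 hk; omega
      simp [this]
  have hpos : 0 < ‖φ (0, x₀)‖ := by rw [hφ0]; exact norm_pos_iff.2 hne
  have hev : ∀ᶠ q in 𝓝 ((0 : ℝ), x₀), ‖φ (0, x₀)‖ / 2 < ‖φ q‖ :=
    (hφc.norm.tendsto _).eventually_const_lt (by linarith)
  obtain ⟨ε, hε, hball⟩ := Metric.eventually_nhds_iff_ball.1 hev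
  have hx₀' : 0 < ‖x₀‖ := norm_pos_iff.2 hx₀
  refine ⟨x₀, min ε (‖x₀‖ / 2), ‖φ (0, x₀)‖ / 2, 2 / ε, by positivity, by positivity, ?_, ?_⟩
  · have := min_le_right ε (‖x₀‖ / 2); linarith
  · intro r hr x hx
    have hr0 : 0 < r := lt_of_lt_of_le (by positivity) hr
    have h1 : ((1 / r : ℝ), x) ∈ Metric.ball ((0 : ℝ), x₀) ε := by
      rw [← ball_prod_same]
      refine ⟨?_, Metric.ball_subset_ball (min_le_left _ _) hx⟩
      rw [mem_ball_zero_iff, Real.norm_eq_abs, abs_of_pos (by positivity), div_lt_iff₀ hr0]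
      rw [div_le_iff₀ hε] at hr
      linarith
    have h2 := (hball _ h1).le
    have h3 : MvPolynomial.eval (fun i => ((r • x) i : 𝕜)) P = (r : 𝕜) ^ n * φ (1 / r, x) := by
      have e1 : (fun i => ((r • x) i : 𝕜)) = fun i => (r : 𝕜) * (x i : 𝕜) := by
        ext i; simp
      have hr' : (r : 𝕜) ≠ 0 := by exact_mod_cast hr0.ne'
      conv_lhs => rw [e1, ← MvPolynomial.sum_homogeneousComponent P]
      rw [map_sum, hφ, Finset.mul_sum]
      refine Finset.sum_congr rfl fun k hk => ?_
      rw [eval_mul_of_isHomogeneous (MvPolynomial.homogeneousComponent_isHomogeneous k P)]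
      have hk' : k ≤ n := Nat.lt_succ_iff.1 (Finset.mem_range.1 hk)
      have e2 : (r : 𝕜) ^ n = (r : 𝕜) ^ k * (r : 𝕜) ^ (n - k) := by
        rw [← pow_add, Nat.add_sub_cancel' hk']
      rw [e2, ← mul_assoc]
      congr 1
      have e3 : (r : 𝕜) ^ (n - k) * (1 / (r : 𝕜)) ^ (n - k) = 1 := by
        rw [← mul_pow, mul_one_div_cancel hr', one_pow]
      simp only [RCLike.ofReal_div, RCLike.ofReal_one]
      rw [mul_assoc, e3, mul_one]
    rw [h3, norm_mul, norm_pow, RCLike.norm_ofReal, abs_of_pos hr0, mul_comm]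
    gcongr

/-- On the ball B(rx₀, rε), of area r²V, the integrand is at least a constant times r^{(n-d)p}. If n
≥ d - 2/p, its integral there is at least δ for all large r, while the integrals over ‖z‖ ≥ k tend
to 0. Equality is excluded as well, hence the strict bound. -/
theorem totalDegree_lt_of_integrable {P : MvPolynomial (Fin 2) 𝕜} (hP : P ≠ 0) {d p : ℝ}
    (hd : 0 ≤ d) (hp : 0 < p)
    (hint : Integrable fun x : QFT.Plane =>
      (‖MvPolynomial.eval (fun i => (x i : 𝕜)) P‖ / (1 + ‖x‖) ^ d) ^ p) :
    (P.totalDegree : ℝ) < d - 2 / p := by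
  by_contra! hcon
  obtain ⟨x₀, ε, c, R, hε, hc, hεx, hle⟩ := exists_le_norm_eval_smul hP
  set n := P.totalDegree
  set F : QFT.Plane → ℝ := fun x =>
    (‖MvPolynomial.eval (fun i => (x i : 𝕜)) P‖ / (1 + ‖x‖) ^ d) ^ p with hF
  have hF0 : ∀ x, 0 ≤ F x := fun x => by positivity
  have hexp : 0 ≤ (n - d) * p + 2 := by
    have h1 : -(2 / p) ≤ n - d := by linarith
    have h2 : -(2 / p) * p ≤ (n - d) * p := by gcongr
    have h3 : -(2 / p) * p = -2 := by field_simp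
    linarith
  set L : ℝ := 1 + ‖x₀‖ + ε
  have hL : 0 < L := by positivity
  set V : ℝ := (volume (Metric.ball (0 : QFT.Plane) ε)).toReal
  have hV : 0 < V := ENNReal.toReal_pos (Metric.measure_ball_pos _ _ hε).ne'
    measure_ball_lt_top.ne
  set δ : ℝ := (c / L ^ d) ^ p * V with hδ
  have hδ0 : 0 < δ := by positivity
  set S : ℕ → Set QFT.Plane := fun k => {z | (k : ℝ) ≤ ‖z‖}
  have hSm : ∀ k, MeasurableSet (S k) := fun k => measurableSet_le measurable_const measurable_norm
  have hlim := tendsto_setIntegral_of_antitone (μ := volume) (f := F) (s := S) hSm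
    (fun i j hij z (hz : (j : ℝ) ≤ ‖z‖) => (Nat.cast_le.2 hij).trans hz) ⟨0, hint.integrableOn⟩
  have hempty : ⋂ k, S k = ∅ := by
    refine eq_empty_of_forall_notMem fun z hz => ?_
    obtain ⟨k, hk⟩ := exists_nat_gt ‖z‖
    exact absurd (mem_iInter.1 hz k) (not_le.2 hk)
  rw [hempty, setIntegral_empty] at hlim
  obtain ⟨N, hN⟩ := (hlim.eventually_lt_const hδ0).exists
  set r : ℝ := max (max R 1) (N / ε) with hr
  have hrR : R ≤ r := (le_max_left _ _).trans (le_max_left _ _)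
  have hr1 : 1 ≤ r := (le_max_right _ _).trans (le_max_left _ _)
  have hrN : N ≤ r * ε := (div_le_iff₀ hε).1 (le_max_right _ _)
  have hr0 : 0 < r := by linarith
  have hball : ∀ z ∈ Metric.ball (r • x₀) (r * ε), ∃ x ∈ Metric.ball x₀ ε, z = r • x := by
    intro z hz
    refine ⟨r⁻¹ • z, ?_, by rw [smul_inv_smul₀ hr0.ne']⟩
    rw [mem_ball_iff_norm] at hz ⊢
    have : r⁻¹ • z - x₀ = r⁻¹ • (z - r • x₀) := by rw [smul_sub, inv_smul_smul₀ hr0.ne']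
    rw [this, norm_smul, norm_inv, Real.norm_eq_abs, abs_of_pos hr0, inv_mul_lt_iff₀ hr0]
    exact hz
  have hsub : Metric.ball (r • x₀) (r * ε) ⊆ S N := by
    intro z hz
    obtain ⟨x, hx, rfl⟩ := hball z hz
    change (N : ℝ) ≤ ‖r • x‖
    rw [norm_smul, Real.norm_eq_abs, abs_of_pos hr0]
    refine hrN.trans (mul_le_mul_of_nonneg_left ?_ hr0.le)
    have h1 := norm_sub_norm_le x₀ x
    rw [mem_ball_iff_norm'] at hx
    linarith
  have hlow : ∀ z ∈ Metric.ball (r • x₀) (r * ε), (c / L ^ d) ^ p * r ^ ((n - d) * p) ≤ F z := by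
    intro z hz
    obtain ⟨x, hx, rfl⟩ := hball z hz
    have h1 : 1 + ‖r • x‖ ≤ r * L := by
      rw [norm_smul, Real.norm_eq_abs, abs_of_pos hr0]
      have h2 : ‖x‖ ≤ ‖x₀‖ + ε := by
        have h3 := norm_sub_norm_le x x₀
        rw [mem_ball_iff_norm] at hx
        linarith
      calc 1 + r * ‖x‖ ≤ r * 1 + r * (‖x₀‖ + ε) := by gcongr; simpa using hr1
        _ = r * L := by ring
    have h4 : c / L ^ d * r ^ ((n : ℝ) - d) ≤
        ‖MvPolynomial.eval (fun i => ((r • x) i : 𝕜)) P‖ / (1 + ‖r • x‖) ^ d := by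
      calc c / L ^ d * r ^ ((n : ℝ) - d) = c * r ^ n / (r * L) ^ d := by
            rw [Real.rpow_sub hr0, Real.mul_rpow hr0.le hL.le, Real.rpow_natCast]
            field_simp
        _ ≤ _ := by
            gcongr
            exact hle r hrR x hx
    calc (c / L ^ d) ^ p * r ^ ((n - d) * p) = (c / L ^ d * r ^ ((n : ℝ) - d)) ^ p := by
          rw [Real.mul_rpow (by positivity) (by positivity), ← Real.rpow_mul hr0.le]
      _ ≤ _ := Real.rpow_le_rpow (by positivity) h4 hp.le
  have hvol : (volume (Metric.ball (r • x₀) (r * ε))).toReal = r ^ 2 * V := by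
    rw [Measure.addHaar_ball_mul _ _ hr0.le, ENNReal.toReal_mul,
      ENNReal.toReal_ofReal (by positivity)]
    simp [V]
  have h1 : δ ≤ ∫ z in Metric.ball (r • x₀) (r * ε), F z := by
    have h2 := setIntegral_mono_on (μ := volume) (s := Metric.ball (r • x₀) (r * ε))
      (f := fun _ => (c / L ^ d) ^ p * r ^ ((n - d) * p)) (g := F)
      (integrableOn_const measure_ball_lt_top.ne) hint.integrableOn measurableSet_ball hlow
    refine le_trans ?_ h2
    rw [setIntegral_const, measureReal_def, hvol, smul_eq_mul]
    have h3 : 1 ≤ r ^ ((n - d) * p + 2) := Real.one_le_rpow hr1 hexp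
    rw [Real.rpow_add hr0, Real.rpow_two] at h3
    calc δ = δ * 1 := (mul_one _).symm
      _ ≤ δ * (r ^ ((n - d) * p) * r ^ 2) := by gcongr
      _ = _ := by rw [hδ]; ring
  have h2 : ∫ z in Metric.ball (r • x₀) (r * ε), F z ≤ ∫ z in S N, F z :=
    setIntegral_mono_set hint.integrableOn (Eventually.of_forall hF0)
      (Eventually.of_forall hsub)
  linarith

end Degree

end CowlingPrice

/-! ### Quaternionic reduction and the two cases -/

namespace CowlingPrice

open Set Filter Topology FourierTransform
open scoped RealInnerProductSpace

theorem exists_real_part (P : MvPolynomial (Fin 2) ℂ) :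
    ∃ R : MvPolynomial (Fin 2) ℝ, R.totalDegree ≤ P.totalDegree ∧ (P = 0 → R = 0) ∧
      ∀ x : Fin 2 → ℝ, MvPolynomial.eval x R = (MvPolynomial.eval (fun i => (x i : ℂ)) P).re := by
  refine ⟨∑ d ∈ P.support, MvPolynomial.monomial d (P.coeff d).re, ?_, ?_, fun x => ?_⟩
  · refine MvPolynomial.totalDegree_finsetSum_le fun d hd => ?_
    exact (MvPolynomial.totalDegree_monomial_le _ _).trans (MvPolynomial.le_totalDegree hd)
  · rintro rfl; simp
  · rw [map_sum, MvPolynomial.eval_eq', Complex.re_sum]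
    refine Finset.sum_congr rfl fun d _ => ?_
    rw [MvPolynomial.eval_monomial, Finsupp.prod_fintype _ _ (fun _ => pow_zero _)]
    have : (∏ i, (x i : ℂ) ^ d i) = ((∏ i, x i ^ d i : ℝ) : ℂ) := by push_cast; rfl
    rw [this, Complex.re_mul_ofReal]

/-- The complex Fourier transform of a real function, read off from the quaternionic one. -/
noncomputable def toComplexL : ℍ[ℝ] →L[ℝ] ℂ :=
  LinearMap.toContinuousLinearMap
    { toFun := fun z => ⟨z.re - z.imK, z.imI + z.imJ⟩
      map_add' := fun z w => by apply Complex.ext <;> simp <;> ring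
      map_smul' := fun r z => by apply Complex.ext <;> simp <;> ring }

theorem toComplexL_apply (z : ℍ[ℝ]) : toComplexL z = ⟨z.re - z.imK, z.imI + z.imJ⟩ := rfl

theorem quaternion_norm_sq (z : ℍ[ℝ]) :
    ‖z‖ ^ 2 = z.re ^ 2 + z.imI ^ 2 + z.imJ ^ 2 + z.imK ^ 2 := by
  rw [pow_two, ← Quaternion.normSq_eq_norm_mul_self, Quaternion.normSq_def']

theorem norm_toComplexL_le (z : ℍ[ℝ]) : ‖toComplexL z‖ ≤ 2 * ‖z‖ := by
  refine abs_le_of_sq_le_sq' ?_ (by positivity) |>.2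
  rw [mul_pow, quaternion_norm_sq, toComplexL_apply, Complex.sq_norm, Complex.normSq_mk]
  nlinarith [sq_nonneg (z.re + z.imK), sq_nonneg (z.imI - z.imJ), sq_nonneg z.re,
    sq_nonneg z.imI, sq_nonneg z.imJ, sq_nonneg z.imK]

theorem norm_cis_le {μ : ℍ[ℝ]} (hμ : ‖μ‖ = 1) (θ : ℝ) : ‖QFT.cis μ θ‖ ≤ 2 := by
  refine (norm_add_le _ _).trans ?_
  rw [norm_mul, hμ, one_mul, Quaternion.norm_coe, Quaternion.norm_coe, Real.norm_eq_abs,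
    Real.norm_eq_abs]
  linarith [Real.abs_cos_le_one θ, Real.abs_sin_le_one θ]

theorem norm_qi : ‖QFT.qi‖ = 1 := by
  rw [← pow_left_inj₀ (norm_nonneg _) zero_le_one two_ne_zero, quaternion_norm_sq]; simp

theorem norm_qj : ‖QFT.qj‖ = 1 := by
  rw [← pow_left_inj₀ (norm_nonneg _) zero_le_one two_ne_zero, quaternion_norm_sq]; simp

theorem continuous_cis (μ : ℍ[ℝ]) : Continuous (QFT.cis μ) := by
  unfold QFT.cis
  exact (Quaternion.continuous_coe.comp Real.continuous_cos).add
    (continuous_const.mul (Quaternion.continuous_coe.comp Real.continuous_sin))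

/-- The map `toComplexL` replaces j by i and k = ij by -1. It is not multiplicative on quaternions,
but on e^{-ia} r e^{-jb} with r real the addition formulas give e^{-i(a+b)} r. -/
theorem toComplexL_cis_mul_cis (a b r : ℝ) :
    toComplexL (QFT.cis QFT.qi (-a) * (r : ℍ[ℝ]) * QFT.cis QFT.qj (-b)) =
      Complex.exp ((-(a + b) : ℝ) * Complex.I) * r := by
  have h : QFT.cis QFT.qi (-a) * (r : ℍ[ℝ]) * QFT.cis QFT.qj (-b) =
      (⟨Real.cos a * r * Real.cos b, -(Real.sin a * r * Real.cos b),
        -(Real.cos a * r * Real.sin b), Real.sin a * r * Real.sin b⟩ : ℍ[ℝ]) := by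
    ext <;> simp [QFT.cis]
  rw [h]
  refine (toComplexL_apply _).trans ?_
  rw [Complex.exp_ofReal_mul_I]
  apply Complex.ext
  · simp [Real.cos_add, -Complex.ofReal_add, -Complex.ofReal_neg, -Complex.ofReal_cos,
      -Complex.ofReal_sin]
    ring
  · simp [Real.sin_add, -Complex.ofReal_add, -Complex.ofReal_neg, -Complex.ofReal_cos,
      -Complex.ofReal_sin]
    ring

theorem fourier_ofReal_eq {g : QFT.Plane → ℝ} (hg : Integrable g) (ξ : QFT.Plane) :
    𝓕 (fun x => (g x : ℂ)) ξ = toComplexL (QFT.fourier (fun x => (g x : ℍ[ℝ])) ξ) := by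
  have hint : Integrable fun x : QFT.Plane =>
      QFT.cis QFT.qi (-(2 * Real.pi * ξ 0 * x 0)) * (g x : ℍ[ℝ]) *
        QFT.cis QFT.qj (-(2 * Real.pi * ξ 1 * x 1)) := by
    refine (hg.norm.const_mul 4).mono' ?_ (Eventually.of_forall fun x => ?_)
    · refine AEStronglyMeasurable.mul (AEStronglyMeasurable.mul ?_ ?_) ?_
      · exact ((continuous_cis _).comp (by fun_prop)).aestronglyMeasurable
      · exact Quaternion.continuous_coe.comp_aestronglyMeasurable hg.aestronglyMeasurable
      · exact ((continuous_cis _).comp (by fun_prop)).aestronglyMeasurable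
    · rw [norm_mul, norm_mul, Quaternion.norm_coe]
      calc _ ≤ 2 * ‖g x‖ * 2 := by
            gcongr
            · exact norm_cis_le norm_qi _
            · exact norm_cis_le norm_qj _
        _ = 4 * ‖g x‖ := by ring
  rw [QFT.fourier, ← toComplexL.integral_comp_comm hint, Real.fourier_eq']
  refine integral_congr_ae (Eventually.of_forall fun x => ?_)
  simp only [toComplexL_cis_mul_cis, smul_eq_mul]
  congr 4
  simp [PiLp.inner_apply]
  ring

theorem norm_component_le (m : Fin 4) (z : ℍ[ℝ]) : |QFT.component m z| ≤ ‖z‖ := by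
  refine abs_le_of_sq_le_sq (?_) (norm_nonneg _)
  rw [quaternion_norm_sq]
  fin_cases m <;> simp [QFT.component] <;>
    nlinarith [sq_nonneg z.re, sq_nonneg z.imI, sq_nonneg z.imJ, sq_nonneg z.imK]

theorem continuous_component (m : Fin 4) : Continuous (QFT.component m) := by
  fin_cases m
  · exact Quaternion.continuous_re
  · exact Quaternion.continuous_imI
  · exact Quaternion.continuous_imJ
  · exact Quaternion.continuous_imK

theorem norm_fourier_component_le (f : QFT.Plane → ℍ[ℝ]) (m : Fin 4) (ξ : QFT.Plane) :
    ‖QFT.fourier (fun x => ((QFT.component m (f x) : ℝ) : ℍ[ℝ])) ξ‖ ≤ QFT.fourierModulus f ξ := by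
  refine Real.le_sqrt_of_sq_le ?_
  exact Finset.single_le_sum (f := fun m : Fin 4 =>
    ‖QFT.fourier (fun x => ((QFT.component m (f x) : ℝ) : ℍ[ℝ])) ξ‖ ^ 2)
    (fun _ _ => by positivity) (Finset.mem_univ m)

theorem le_one_add_rpow {t p : ℝ} (ht : 0 ≤ t) (hp : 1 ≤ p) : t ≤ 1 + t ^ p := by
  rcases le_total t 1 with h | h
  · have := Real.rpow_nonneg ht p; linarith
  · have := Real.rpow_le_rpow_of_exponent_le h hp
    rw [Real.rpow_one] at this; linarith

/-- Converts the weighted integrability hypothesis into a pointwise bound (1 + w) times a natural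
power, where w is the integrand of the hypothesis. -/
theorem mul_exp_le_of_weight {a r d e p : ℝ} (ha : 0 ≤ a) (hr : 0 ≤ r) (hp : 1 ≤ p) :
    Real.exp e * a ≤ (1 + (a / (1 + r) ^ d * Real.exp e) ^ p) * (1 + r) ^ ⌈d⌉₊ := by
  have h1 : (1 + r) ^ d ≤ (1 + r) ^ ⌈d⌉₊ := by
    rw [← Real.rpow_natCast]
    exact Real.rpow_le_rpow_of_exponent_le (by linarith) (Nat.le_ceil d)
  have h2 : 0 < (1 + r) ^ d := by positivity
  calc Real.exp e * a = (a / (1 + r) ^ d * Real.exp e) * (1 + r) ^ d := by field_simp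
    _ ≤ _ := by
      gcongr
      exact le_one_add_rpow (by positivity) hp

/-- The critical case for one real component. The majorant `h` stands for the modulus of the
transform of the whole function. -/
theorem exists_real_polynomial {p q d₁ d₂ α β : ℝ} (hp : 1 < p) (hq : 1 < q) (hd₁ : 0 ≤ d₁)
    (hd₂ : 0 ≤ d₂) (hα : 0 < α) (hβ : 0 < β) (hαβ : α * β = 1 / 4) {g : QFT.Plane → ℝ}
    {h : QFT.Plane → ℝ} (hgm : AEStronglyMeasurable g volume)
    (hgp : Integrable fun x : QFT.Plane =>
      (|g x| / (1 + ‖x‖) ^ d₁ * Real.exp (2 * Real.pi * α * ‖x‖ ^ 2)) ^ p)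
    (hgh : ∀ y, ‖QFT.fourier (fun x => (g x : ℍ[ℝ])) y‖ ≤ h y)
    (hhq : Integrable fun y : QFT.Plane =>
      (h y / (1 + ‖y‖) ^ d₂ * Real.exp (2 * Real.pi * β * ‖y‖ ^ 2)) ^ q) :
    ∃ P : MvPolynomial (Fin 2) ℝ,
      (P ≠ 0 → (P.totalDegree : ℝ) < min (d₁ - 2 / p) (d₂ - 2 / q)) ∧
      g =ᵐ[volume] fun x =>
        Real.exp (-(2 * Real.pi * α * ‖x‖ ^ 2)) * MvPolynomial.eval (fun i => x i) P := by
  have hπ := Real.pi_pos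
  set b : ℝ := 2 * Real.pi * α with hb
  set c : ℝ := 2 * Real.pi * β with hc
  have hb0 : 0 < b := by positivity
  have hc0 : 0 < c := by positivity
  -- This is the only place where αβ = 1/4 enters: the Gaussians with parameters b and c are Fourier
  -- dual.
  have hbc : b * c = Real.pi ^ 2 := by
    rw [hb, hc]; linear_combination 4 * Real.pi ^ 2 * hαβ
  have hbc1 : Real.pi ^ 2 / b = c := by rw [← hbc]; field_simp
  have hbc2 : Real.pi ^ 2 / c = b := by rw [← hbc]; field_simp
  set G : QFT.Plane → ℂ := fun x => (g x : ℂ) with hG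
  have hGm : AEStronglyMeasurable G volume :=
    Complex.continuous_ofReal.comp_aestronglyMeasurable hgm
  have hGb : ∀ x, ‖G x‖ ≤ (1 + (|g x| / (1 + ‖x‖) ^ d₁ * Real.exp (b * ‖x‖ ^ 2)) ^ p) *
      ((1 + ‖x‖) ^ ⌈d₁⌉₊ * Real.exp (-(b * ‖x‖ ^ 2))) := fun x => by
    have h1 := mul_exp_le_of_weight (d := d₁) (e := b * ‖x‖ ^ 2) (abs_nonneg (g x))
      (norm_nonneg x) hp.le
    rw [hG, Complex.norm_real, Real.norm_eq_abs, ← mul_assoc, Real.exp_neg,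
      ← div_eq_mul_inv, le_div_iff₀ (Real.exp_pos _), mul_comm]
    exact h1
  have hGi : Integrable G := integrable_of_gaussian_bound hb0 hGm hgp hGb
  have hgi : Integrable g := by
    have := hGi.re
    simpa [hG] using this
  have hFc : Continuous (𝓕 G) :=
    VectorFourier.fourierIntegral_continuous Real.continuous_fourierChar continuous_inner hGi
  have hFq : Integrable fun y : QFT.Plane =>
      (‖𝓕 G y‖ / (1 + ‖y‖) ^ d₂ * Real.exp (c * ‖y‖ ^ 2)) ^ q := by
    refine (hhq.const_mul (2 ^ q)).mono' (Continuous.aestronglyMeasurable ?_)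
      (Eventually.of_forall fun y => ?_)
    · refine Continuous.rpow_const ?_ fun _ => Or.inr (by linarith)
      refine Continuous.mul (hFc.norm.div₀ ?_ fun y => ?_) (by fun_prop)
      · exact Continuous.rpow_const (by fun_prop) fun _ => Or.inr hd₂
      · positivity
    · have h1 : ‖𝓕 G y‖ ≤ 2 * h y := by
        rw [hG, fourier_ofReal_eq hgi]
        exact (norm_toComplexL_le _).trans (by linarith [hgh y])
      have h0 : 0 ≤ h y := (norm_nonneg _).trans (hgh y)
      rw [Real.norm_eq_abs, abs_of_nonneg (by positivity),
        ← Real.mul_rpow (by norm_num) (by positivity)]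
      refine Real.rpow_le_rpow (by positivity) ?_ (by linarith)
      calc _ ≤ (2 * h y) / (1 + ‖y‖) ^ d₂ * Real.exp (c * ‖y‖ ^ 2) := by gcongr
        _ = _ := by ring
  obtain ⟨Q, hQ⟩ := exists_mvPolynomial_fourier_eq hb0 hGm hgp (fun x => by positivity) hFq
    (fun y => by positivity) hGb (m := ⌈d₂⌉₊) (fun y => by
      rw [hbc1]; exact mul_exp_le_of_weight (norm_nonneg _) (norm_nonneg _) hq.le)
  rw [hbc1] at hQ
  have hQ' : ∀ ξ : QFT.Plane, 𝓕 G ξ =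
      MvPolynomial.eval ![(ξ 0 : ℂ), ξ 1] Q * (Real.exp (-(c * ‖ξ‖ ^ 2)) : ℂ) := fun ξ => by
    rw [← hQ, mul_right_comm, ← Complex.ofReal_mul, ← Real.exp_add]; simp
  obtain ⟨P, hPQ, hP0, hP⟩ := exists_ae_eq_eval_mul_gaussian hGi hc0 hQ'
  rw [hbc2] at hP
  obtain ⟨R, hRP, hR0, hR⟩ := exists_real_part P
  have hvec : ∀ x : QFT.Plane, ![(x 0 : ℂ), x 1] = fun i => (x i : ℂ) := fun x => by
    ext i; fin_cases i <;> rfl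
  have hgR : g =ᵐ[volume] fun x =>
      Real.exp (-(b * ‖x‖ ^ 2)) * MvPolynomial.eval (fun i => x i) R := by
    filter_upwards [hP] with x hx
    rw [hR, mul_comm, ← Complex.re_mul_ofReal, ← hvec, ← hx]
    rfl
  refine ⟨R, fun hne => lt_min ?_ ?_, hgR⟩
  · refine totalDegree_lt_of_integrable hne hd₁ (by linarith) (hgp.congr ?_)
    filter_upwards [hgR] with x hx
    rw [hx, abs_mul, abs_of_pos (Real.exp_pos _), div_mul_eq_mul_div, mul_right_comm,
      ← Real.exp_add]
    simp
  -- The weight on the frequency side bounds deg Q, and deg R ≤ deg P ≤ deg Q.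
  · have hQne : Q ≠ 0 := fun h0 => hne (hR0 (hP0 h0))
    refine lt_of_le_of_lt (Nat.cast_le.2 (hRP.trans hPQ))
      (totalDegree_lt_of_integrable hQne hd₂ (by linarith) (hFq.congr ?_))
    refine Eventually.of_forall fun y => ?_
    have h1 := congrArg norm (hQ y)
    rw [norm_mul, Complex.norm_real, Real.norm_eq_abs, abs_of_pos (Real.exp_pos _), hvec] at h1
    simp only [Complex.coe_algebraMap]
    rw [← h1]
    ring_nf

/-- The critical case of the Cowling–Price theorem for quaternion-valued functions. -/
theorem exists_polyEval_of_mul_eq {p q d₁ d₂ α β : ℝ} (hp : 1 < p) (hq : 1 < q) (hd₁ : 0 ≤ d₁)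
    (hd₂ : 0 ≤ d₂) (hα : 0 < α) (hβ : 0 < β) (hαβ : α * β = 1 / 4) {f : QFT.Plane → ℍ[ℝ]}
    (hfm : AEStronglyMeasurable f volume)
    (hfp : Integrable (fun x : QFT.Plane =>
      (‖f x‖ / (1 + ‖x‖) ^ d₁ * Real.exp (2 * Real.pi * α * ‖x‖ ^ 2)) ^ p) volume)
    (hfq : Integrable (fun y : QFT.Plane =>
      (QFT.fourierModulus f y / (1 + ‖y‖) ^ d₂ * Real.exp (2 * Real.pi * β * ‖y‖ ^ 2)) ^ q)
      volume) :
    ∃ P : Fin 4 → MvPolynomial (Fin 2) ℝ,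
      QFT.DegreeLT P (min (d₁ - 2 / p) (d₂ - 2 / q)) ∧
      f =ᵐ[volume] fun x => Real.exp (-(2 * Real.pi * α * ‖x‖ ^ 2)) • QFT.polyEval P x := by
  have hm : ∀ m : Fin 4, AEStronglyMeasurable (fun x => QFT.component m (f x)) volume :=
    fun m => (continuous_component m).comp_aestronglyMeasurable hfm
  choose P hPd hP using fun m : Fin 4 => exists_real_polynomial hp hq hd₁ hd₂ hα hβ hαβ
    (g := fun x => QFT.component m (f x)) (h := QFT.fourierModulus f) (hm m)
    (hfp.mono' (by
      refine AEMeasurable.aestronglyMeasurable (AEMeasurable.pow_const (AEMeasurable.mul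
        (AEMeasurable.div (hm m).norm.aemeasurable ?_) ?_) p)
      · fun_prop
      · fun_prop) (Eventually.of_forall fun x => by
        rw [Real.norm_eq_abs, abs_of_nonneg (by positivity)]
        have := norm_component_le m (f x)
        gcongr))
    (norm_fourier_component_le f m) hfq
  refine ⟨P, hPd, ?_⟩
  filter_upwards [hP 0, hP 1, hP 2, hP 3] with x h0 h1 h2 h3
  ext
  · exact h0
  · exact h1
  · exact h2
  · exact h3

/-- The supercritical case of the Cowling–Price theorem for quaternion-valued functions. -/
theorem ae_eq_zero_of_lt_mul {p q d₁ d₂ α β : ℝ} (hp : 1 < p) (hq : 1 < q) (hd₂ : 0 ≤ d₂)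
    (hβ : 0 < β) (h : 1 / 4 < α * β) {f : QFT.Plane → ℍ[ℝ]}
    (hfm : AEStronglyMeasurable f volume)
    (hfp : Integrable (fun x : QFT.Plane =>
      (‖f x‖ / (1 + ‖x‖) ^ d₁ * Real.exp (2 * Real.pi * α * ‖x‖ ^ 2)) ^ p) volume)
    (hfq : Integrable (fun y : QFT.Plane =>
      (QFT.fourierModulus f y / (1 + ‖y‖) ^ d₂ * Real.exp (2 * Real.pi * β * ‖y‖ ^ 2)) ^ q)
      volume) :
    f =ᵐ[volume] 0 := by
  have hlt : 1 / (4 * β) < α := by rw [div_lt_iff₀ (by positivity)]; linarith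
  have hb : 0 < 2 * Real.pi * (α - 1 / (4 * β)) :=
    mul_pos Real.two_pi_pos (by linarith)
  -- The critical value for β. The gap α - α' > 0 supplies the Gaussian that absorbs (1+r)^d₁ into
  -- the constant `K`.
  set α' : ℝ := 1 / (4 * β) with hα'
  set K : ℝ := Real.exp ((⌈d₁⌉₊ + 0) ^ 2 / (2 * (2 * Real.pi * (α - α'))))
  have hK : ∀ r : ℝ, 0 ≤ r → (1 + r) ^ d₁ * Real.exp (2 * Real.pi * α' * r ^ 2) ≤
      K * Real.exp (2 * Real.pi * α * r ^ 2) := by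
    intro r hr
    have h1 := weight_le hb ⌈d₁⌉₊ 0 hr
    have h2 : (1 + r) ^ d₁ ≤ (1 + r) ^ ⌈d₁⌉₊ := by
      rw [← Real.rpow_natCast]
      exact Real.rpow_le_rpow_of_exponent_le (by linarith) (Nat.le_ceil d₁)
    have h3 : Real.exp (-(2 * Real.pi * (α - α') / 2 * r ^ 2)) ≤ 1 :=
      Real.exp_le_one_iff.2 (neg_nonpos.2 (by positivity))
    rw [zero_mul, Real.exp_zero, mul_one] at h1
    have h4 : (1 + r) ^ d₁ * Real.exp (-(2 * Real.pi * (α - α') * r ^ 2)) ≤ K :=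
      (mul_le_mul_of_nonneg_right h2 (Real.exp_pos _).le).trans
        (h1.trans (mul_le_of_le_one_right (Real.exp_pos _).le h3))
    calc (1 + r) ^ d₁ * Real.exp (2 * Real.pi * α' * r ^ 2)
        = ((1 + r) ^ d₁ * Real.exp (-(2 * Real.pi * (α - α') * r ^ 2))) *
          Real.exp (2 * Real.pi * α * r ^ 2) := by
          rw [mul_assoc ((1 + r) ^ d₁), ← Real.exp_add]; ring_nf
      _ ≤ _ := by gcongr
  have hfp' : Integrable (fun x : QFT.Plane =>
      (‖f x‖ / (1 + ‖x‖) ^ (0 : ℝ) * Real.exp (2 * Real.pi * α' * ‖x‖ ^ 2)) ^ p) volume := by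
    refine (hfp.const_mul (K ^ p)).mono' ?_ (Filter.Eventually.of_forall fun x => ?_)
    · refine AEMeasurable.aestronglyMeasurable (AEMeasurable.pow_const (AEMeasurable.mul
        (AEMeasurable.div hfm.norm.aemeasurable ?_) ?_) p)
      · fun_prop
      · fun_prop
    · rw [Real.norm_eq_abs, abs_of_nonneg (by positivity),
        ← Real.mul_rpow (Real.exp_pos _).le (by positivity), Real.rpow_zero, div_one]
      refine Real.rpow_le_rpow (by positivity) ?_ (by linarith)
      have h1 : 0 < (1 + ‖x‖) ^ d₁ := by positivity
      calc ‖f x‖ * Real.exp (2 * Real.pi * α' * ‖x‖ ^ 2)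
          = ‖f x‖ / (1 + ‖x‖) ^ d₁ *
            ((1 + ‖x‖) ^ d₁ * Real.exp (2 * Real.pi * α' * ‖x‖ ^ 2)) := by field_simp
        _ ≤ ‖f x‖ / (1 + ‖x‖) ^ d₁ * (K * Real.exp (2 * Real.pi * α * ‖x‖ ^ 2)) := by
            exact mul_le_mul_of_nonneg_left (hK _ (norm_nonneg x)) (by positivity)
        _ = _ := by ring
  -- With weight exponent 0 the degree would have to be below -2/p, so every component of P is zero.
  obtain ⟨P, hPd, hP⟩ := exists_polyEval_of_mul_eq hp hq le_rfl hd₂ (by positivity) hβ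
    (by rw [hα']; field_simp) hfm hfp' hfq
  have hP0 : ∀ m, P m = 0 := fun m => by
    by_contra hne
    have h1 := (hPd m hne).trans_le (min_le_left _ _)
    have h2 : 0 < 2 / p := by positivity
    have h3 : (0 : ℝ) ≤ (P m).totalDegree := Nat.cast_nonneg _
    linarith
  filter_upwards [hP] with x hx
  have hx0 : QFT.polyEval P x = 0 := by
    simp only [QFT.polyEval, hP0, map_zero]
    rfl
  rw [hx, hx0, smul_zero]
  rfl

end CowlingPrice

theorem corollary5p4 (p q : ℝ) (hp : 1 < p) (hq : 1 < q) (hpq : 1 / p + 1 / q = 1)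
    (d₁ d₂ : ℝ) (hd₁ : 0 ≤ d₁) (hd₂ : 0 ≤ d₂) (α β : ℝ) (hα : 0 < α) (hβ : 0 < β)
    (f : QFT.Plane → ℍ[ℝ]) (hf : MemLp f 2 volume)
    (hfp : Integrable (fun x : QFT.Plane =>
      (‖f x‖ / (1 + ‖x‖) ^ d₁ * Real.exp (2 * Real.pi * α * ‖x‖ ^ 2)) ^ p) volume)
    (hfq : Integrable (fun y : QFT.Plane =>
      (QFT.fourierModulus f y / (1 + ‖y‖) ^ d₂ * Real.exp (2 * Real.pi * β * ‖y‖ ^ 2)) ^ q)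
      volume) :
    (1 / 4 < α * β → f =ᵐ[volume] 0) ∧
    (α * β = 1 / 4 → ∃ P : Fin 4 → MvPolynomial (Fin 2) ℝ,
      QFT.DegreeLT P (min (d₁ - 2 / p) (d₂ - 2 / q)) ∧
      f =ᵐ[volume] fun x => Real.exp (-(2 * Real.pi * α * ‖x‖ ^ 2)) • QFT.polyEval P x) := by
  exact ⟨fun h => CowlingPrice.ae_eq_zero_of_lt_mul hp hq hd₂ hβ h hf.aestronglyMeasurable hfp hfq,
    fun h => CowlingPrice.exists_polyEval_of_mul_eq hp hq hd₁ hd₂ hα hβ h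
      hf.aestronglyMeasurable hfp hfq⟩
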